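/- Let $(G_n)_{n\ge 1}=((V_n,E_n))_{n\ge 1}$ be a sequence of finite connected graphs that converges in the Benjamini–Schramm sense to a random rooted graph $(G,\rho)=((V,E),\rho)$ which is almost surely infinite; that is, if $\rho_n$ is a uniformly random vertex of $G_n$, then $(G_n,\rho_n)$ converges in distribution to $(G,\rho)$ with respect to the local topology on connected, locally finite rooted graphs. Suppose that there is a constant $C<\infty$ such that $|V_n|\le C\operatorname{diam}(G_n)$ for every $n\ge 1$. Then there exists an event $\Omega$ of probability at least $1/C$ on which the following hold almost surely: 1. $G$ is two-ended (the maximal number of infinite connected components that can result from deleting a finite set of vertices of $G$ is $2$) and has linear growth ($\limsup_{r\to\infty}\frac1r|B_r(G,v)|<\infty$ for some, and hence every, vertex $v$, where $B_r(G,v)$ is the ball of radius $r$ around $v$ in the graph metric). 2. The pointed metric space $(V,\varepsilon d_G,\rho)$, where $d_G$ is the graph metric, converges to $(\mathbb{R},|\cdot|,0)$ in the local Gromov–Hausdorff topology as $\varepsilon\downarrow 0$. Here this topology is the one induced by the metric $\sum_{r\ge1}2^{-r}d_{\mathrm{GH}}(B_X(x_0,r),B_Y(y_0,r))$, where $B_X(x_0,r)$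 is the closed ball of radius $r$ around the distinguished point, and $d_{\mathrm{GH}}$ is the pointed Gromov–Hausdorff distance, i.e. half the infimal distortion of a correspondence that relates the distinguished points. -/

import Mathlib

open Filter Topology MeasureTheory
open scoped ENNReal

namespace BSLimit

universe u v

/-! ### Rooted graphs and the local topology -/

/-- The closed ball of radius `r` around the vertex `x`, as a set of vertices. -/
def graphBall {V : Type u} (G : SimpleGraph V) (x : V) (r : ℕ) : Set V :=
  {y | G.edist x y ≤ r}

lemma mem_graphBall_self {V : Type u} (G : SimpleGraph V) (x : V) (r : ℕ) :
    x ∈ graphBall G x r := by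
  simp [graphBall]

/-- A rooted graph: a connected, locally finite graph with a distinguished vertex. -/
structure RootedGraph : Type (u + 1) where
  /-- the vertex set -/
  V : Type u
  /-- the graph -/
  graph : SimpleGraph V
  /-- the root -/
  root : V
  connected : graph.Connected
  locallyFinite : ∀ x, (graph.neighborSet x).Finite

/-- The balls of radius `r` around the roots of `g` and `h` (induced subgraphs, rooted at the
same roots) are isomorphic as rooted graphs. -/
def BallIso (g h : RootedGraph.{u}) (r : ℕ) : Prop :=
  ∃ e : g.graph.induce (graphBall g.graph g.root r) ≃g h.graph.induce (graphBall h.graph h.root r),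
    e ⟨g.root, mem_graphBall_self _ _ _⟩ = ⟨h.root, mem_graphBall_self _ _ _⟩

lemma BallIso.refl (g : RootedGraph.{u}) (r : ℕ) : BallIso g g r :=
  ⟨SimpleGraph.Iso.refl, rfl⟩

lemma BallIso.symm {g h : RootedGraph.{u}} {r : ℕ} (H : BallIso g h r) : BallIso h g r := by
  obtain ⟨e, he⟩ := H
  exact ⟨e.symm, by rw [← he]; simp⟩

lemma BallIso.trans {g h k : RootedGraph.{u}} {r : ℕ} (H : BallIso g h r) (K : BallIso h k r) :
    BallIso g k r := by
  obtain ⟨e, he⟩ := H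
  obtain ⟨f, hf⟩ := K
  exact ⟨e.trans f, by rw [← hf, ← he]; rfl⟩

lemma edist_map_le {g h : RootedGraph.{u}} {r : ℕ}
    (e : g.graph.induce (graphBall g.graph g.root r) ≃g
      h.graph.induce (graphBall h.graph h.root r))
    (he : e ⟨g.root, mem_graphBall_self _ _ _⟩ = ⟨h.root, mem_graphBall_self _ _ _⟩) (n : ℕ) :
    ∀ x : graphBall g.graph g.root r, g.graph.edist g.root x ≤ n →
      h.graph.edist h.root (e x) ≤ n := by
  induction n with
  | zero =>
    intro x hx
    have hx' : g.root = x := by simpa using hx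
    have : x = ⟨g.root, mem_graphBall_self _ _ _⟩ := Subtype.ext hx'.symm
    rw [this, he]; simp
  | succ n ih =>
    intro x hx
    by_cases hle : g.graph.edist g.root x ≤ n
    · exact (ih x hle).trans (by exact_mod_cast Nat.le_succ n)
    · obtain ⟨w, hw⟩ := (g.connected g.root x).exists_walk_length_eq_edist
      have hlen : w.length ≤ n + 1 := by
        rw [← hw] at hx; exact_mod_cast hx
      have hpos : ¬ w.length ≤ n := fun h' => hle (by rw [← hw]; exact_mod_cast h')
      have hnil : ¬ w.Nil := by
        intro h'
        exact hpos (by rw [SimpleGraph.Walk.length_eq_zero_iff.2 h']; exact Nat.zero_le n)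
      have hadj : g.graph.Adj w.penultimate x := w.adj_penultimate hnil
      have hd : g.graph.edist g.root w.penultimate ≤ n := by
        refine (SimpleGraph.edist_le w.dropLast).trans ?_
        have : w.dropLast.length ≤ n := by
          have := SimpleGraph.Walk.length_dropLast_add_one hnil
          omega
        exact_mod_cast this
      have hx2 : g.graph.edist g.root x ≤ r := x.2
      have hmem : w.penultimate ∈ graphBall g.graph g.root r := by
        refine hd.trans ?_
        have : w.length ≤ r := by rw [← hw] at hx2; exact_mod_cast hx2
        exact_mod_cast (by omega : n ≤ r)
      have h1 := ih ⟨w.penultimate, hmem⟩ hd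
      have hadj' : h.graph.Adj (e ⟨w.penultimate, hmem⟩) (e x) :=
        e.map_rel_iff.2 (show (g.graph.induce _).Adj ⟨w.penultimate, hmem⟩ x from hadj)
      calc h.graph.edist h.root (e x)
          ≤ h.graph.edist h.root (e ⟨w.penultimate, hmem⟩)
            + h.graph.edist (e ⟨w.penultimate, hmem⟩ : h.V) (e x) :=
            SimpleGraph.edist_triangle
        _ ≤ n + 1 := by
            gcongr
            exact (SimpleGraph.edist_le hadj'.toWalk).trans (by simp)
        _ = ((n + 1 : ℕ) : ℕ∞) := by push_cast; rfl

lemma BallIso.mono {g h : RootedGraph.{u}} {r s : ℕ} (hs : s ≤ r) (H : BallIso g h r) :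
    BallIso g h s := by
  obtain ⟨e, he⟩ := H
  have he' : e.symm ⟨h.root, mem_graphBall_self _ _ _⟩ = ⟨g.root, mem_graphBall_self _ _ _⟩ := by
    rw [← he]; simp
  have sub : ∀ k : RootedGraph.{u}, ∀ x ∈ graphBall k.graph k.root s,
      x ∈ graphBall k.graph k.root r := fun k x hx =>
    le_trans (show k.graph.edist k.root x ≤ s from hx) (by exact_mod_cast hs)
  refine ⟨⟨⟨fun x => ⟨e ⟨x, sub g x x.2⟩, edist_map_le e he s _ x.2⟩,
    fun y => ⟨e.symm ⟨y, sub h y y.2⟩, edist_map_le e.symm he' s _ y.2⟩, ?_, ?_⟩, ?_⟩, ?_⟩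
  · intro x; ext; simp
  · intro y; ext; simp
  · intro x y
    exact e.map_rel_iff (a := ⟨x, sub g x x.2⟩) (b := ⟨y, sub g y y.2⟩)
  · have h1 := congrArg Subtype.val he
    exact Subtype.ext h1

/-- The supremum of the radii `r` for which the balls of radius `r` around the two roots are
isomorphic as rooted graphs. -/
noncomputable def agreeRadius (g h : RootedGraph.{u}) : ℕ∞ :=
  ⨆ (r : ℕ) (_ : BallIso g h r), (r : ℕ∞)

/-- The local distance `2 ^ (-R)`, where `R` is `agreeRadius` (and `2 ^ (-∞) = 0`). -/
noncomputable def dLoc (g h : RootedGraph.{u}) : ℝ :=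
  open Classical in
  if agreeRadius g h = ⊤ then 0 else (1 / 2 : ℝ) ^ (agreeRadius g h).toNat

lemma agreeRadius_self (g : RootedGraph.{u}) : agreeRadius g g = ⊤ := by
  refine ENat.eq_top_iff_forall_ge.2 fun n => ?_
  exact le_iSup₂_of_le n (BallIso.refl g n) le_rfl

lemma agreeRadius_comm (g h : RootedGraph.{u}) : agreeRadius g h = agreeRadius h g :=
  iSup_congr fun _ => iSup_congr_Prop ⟨BallIso.symm, BallIso.symm⟩ fun _ => rfl

lemma min_agreeRadius_le (g h k : RootedGraph.{u}) :
    min (agreeRadius g h) (agreeRadius h k) ≤ agreeRadius g k := by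
  refine le_of_forall_lt fun a ha => ?_
  rw [lt_min_iff] at ha
  obtain ⟨h1, h2⟩ := ha
  simp only [agreeRadius, lt_iSup_iff] at h1 h2
  obtain ⟨r, hr, har⟩ := h1
  obtain ⟨s, hs, has⟩ := h2
  have : BallIso g k (min r s) := (hr.mono (min_le_left _ _)).trans (hs.mono (min_le_right _ _))
  refine lt_of_lt_of_le (lt_min har has) ?_
  have h3 : ((min r s : ℕ) : ℕ∞) ≤ agreeRadius g k :=
    le_iSup₂_of_le (f := fun (r : ℕ) (_ : BallIso g k r) => (r : ℕ∞)) _ this le_rfl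
  rwa [(Nat.mono_cast (α := ℕ∞)).map_min] at h3

lemma dLoc_nonneg (g h : RootedGraph.{u}) : 0 ≤ dLoc g h := by
  unfold dLoc; split_ifs <;> positivity

lemma dLoc_le_of_le {g h g' h' : RootedGraph.{u}} (H : agreeRadius g h ≤ agreeRadius g' h') :
    dLoc g' h' ≤ dLoc g h := by
  by_cases h1 : agreeRadius g' h' = ⊤
  · have : dLoc g' h' = 0 := by simp [dLoc, h1]
    rw [this]; exact dLoc_nonneg _ _
  · have h2 : agreeRadius g h ≠ ⊤ := fun h => h1 (top_le_iff.1 (h ▸ H))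
    simp only [dLoc, h1, h2, if_false]
    exact pow_le_pow_of_le_one (by norm_num) (by norm_num) (ENat.toNat_le_toNat H h1)

/-- The local metric on rooted graphs. Isomorphic rooted graphs are not identified here, so that it
is only a pseudometric: two rooted graphs have distance zero precisely if they agree as points of
the space of isomorphism classes, and open sets and Borel sets are the preimages of those of the
latter space. -/
noncomputable instance : PseudoMetricSpace RootedGraph.{u} where
  dist := dLoc
  dist_self g := by simp [dLoc, agreeRadius_self]
  dist_comm g h := by simp only [dLoc, agreeRadius_comm]
  dist_triangle g h k := by
    rcases min_le_iff.1 (min_agreeRadius_le g h k) with H | H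
    · exact (dLoc_le_of_le H).trans (le_add_of_nonneg_right (dLoc_nonneg _ _))
    · exact (dLoc_le_of_le H).trans (le_add_of_nonneg_left (dLoc_nonneg _ _))

noncomputable instance : MeasurableSpace RootedGraph.{u} := borel _

instance : BorelSpace RootedGraph.{u} := ⟨rfl⟩

/-! ### Benjamini-Schramm convergence -/

/-- A finite connected graph, rooted at one of its vertices. -/
def rootAt {V : Type u} [Fintype V] (G : SimpleGraph V) (hG : G.Connected) (x : V) :
    RootedGraph.{u} where
  V := V
  graph := G
  root := x
  connected := hG
  locallyFinite _ := Set.toFinite _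

/-- The law of `(G, ρ)`, where `G` is a finite connected graph and `ρ` is a uniform random vertex
of `G`. -/
noncomputable def uniformRootLaw {V : Type u} [Fintype V] (G : SimpleGraph V) (hG : G.Connected) :
    ProbabilityMeasure RootedGraph.{u} :=
  haveI : Nonempty V := hG.nonempty
  ⟨((PMF.uniformOfFintype V).map (rootAt G hG)).toMeasure, inferInstance⟩

/-- The law of a random rooted graph. -/
noncomputable def law {S : Type v} [MeasurableSpace S] (P : Measure S) [IsProbabilityMeasure P]
    (X : S → RootedGraph.{u}) (hX : Measurable X) : ProbabilityMeasure RootedGraph.{u} :=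
  ⟨P.map X, Measure.isProbabilityMeasure_map hX.aemeasurable⟩

/-- The finite connected graphs `G n` Benjamini-Schramm converge to the random rooted graph `X`:
if `ρ n` is a uniform random vertex of `G n`, then `(G n, ρ n)` converges in distribution to `X`
with respect to the local topology. -/
def BenjaminiSchrammConverges {V : ℕ → Type u} [∀ n, Fintype (V n)]
    (G : ∀ n, SimpleGraph (V n)) (hG : ∀ n, (G n).Connected)
    {S : Type v} [MeasurableSpace S] (P : Measure S) [IsProbabilityMeasure P]
    (X : S → RootedGraph.{u}) (hX : Measurable X) : Prop :=
  Tendsto (fun n => uniformRootLaw (G n) (hG n)) atTop (𝓝 (law P X hX))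

/-! ### Ends and growth -/

/-- `G` is `k`-ended: `k` is the maximal number of infinite connected components that result from
deleting a finite set of vertices. -/
def IsEnded {V : Type u} (G : SimpleGraph V) (k : ℕ) : Prop :=
  IsGreatest (Set.range fun K : Finset V =>
    Set.encard {C : G.ComponentCompl (K : Set V) | C.supp.Infinite}) (k : ℕ∞)

/-- `G` has linear growth: `limsup |B_n(G, x)| / n < ∞` for some vertex `x`. -/
def HasLinearGrowth {V : Type u} (G : SimpleGraph V) : Prop :=
  ∃ x : V, limsup (fun n : ℕ => ((graphBall G x n).encard : ℝ≥0∞) / (n : ℝ≥0∞)) atTop < ⊤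

/-! ### The local Gromov-Hausdorff topology -/

/-- A pointed metric space. -/
structure PointedMetricSpace : Type (u + 1) where
  /-- the points -/
  carrier : Type u
  /-- the metric -/
  metric : MetricSpace carrier
  /-- the distinguished point -/
  pt : carrier

/-- The distance between two points of a pointed metric space. -/
def PointedMetricSpace.d (X : PointedMetricSpace.{u}) (x y : X.carrier) : ℝ :=
  X.metric.dist x y

/-- The closed ball of radius `r ≥ 0` around the distinguished point, as a pointed metric space. -/
def PointedMetricSpace.closedBall (X : PointedMetricSpace.{u}) (r : ℝ) (hr : 0 ≤ r) :
    PointedMetricSpace.{u} where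
  carrier := {x : X.carrier // X.d x X.pt ≤ r}
  metric := letI := X.metric; inferInstance
  pt := ⟨X.pt, le_of_eq_of_le (letI := X.metric; dist_self X.pt) hr⟩

/-- `R` is a correspondence between pointed metric spaces. -/
def IsCorrespondence (X : PointedMetricSpace.{u}) (Y : PointedMetricSpace.{v})
    (R : Set (X.carrier × Y.carrier)) : Prop :=
  (∀ x, ∃ y, (x, y) ∈ R) ∧ (∀ y, ∃ x, (x, y) ∈ R) ∧ (X.pt, Y.pt) ∈ R

/-- The distortion of a correspondence. -/
noncomputable def distortion (X : PointedMetricSpace.{u}) (Y : PointedMetricSpace.{v})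
    (R : Set (X.carrier × Y.carrier)) : ℝ≥0∞ :=
  ⨆ (p ∈ R) (q ∈ R), ENNReal.ofReal |X.d p.1 q.1 - Y.d p.2 q.2|

/-- The (pointed) Gromov-Hausdorff distance. -/
noncomputable def dGH (X : PointedMetricSpace.{u}) (Y : PointedMetricSpace.{v}) : ℝ≥0∞ :=
  (1 / 2) * ⨅ (R : Set (X.carrier × Y.carrier)) (_ : IsCorrespondence X Y R), distortion X Y R

/-- The local Gromov-Hausdorff distance `∑_{r ≥ 1} 2 ^ (-r) d_GH(B_X(r), B_Y(r))`. -/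
noncomputable def dGHloc (X : PointedMetricSpace.{u}) (Y : PointedMetricSpace.{v}) : ℝ≥0∞ :=
  ∑' r : ℕ, (1 / 2) ^ (r + 1) *
    dGH (X.closedBall ((r : ℝ) + 1) (by positivity)) (Y.closedBall ((r : ℝ) + 1) (by positivity))

/-- The pointed metric space `(ℝ, |x - y|, 0)`. -/
noncomputable def realLine : PointedMetricSpace.{0} where
  carrier := ℝ
  metric := inferInstance
  pt := 0

/-- The pointed metric space `(V, ε d_G, ρ)` of a rooted graph `g = (G, ρ)`. -/
noncomputable def RootedGraph.rescaled (g : RootedGraph.{u}) (ε : ℝ) (hε : 0 < ε) :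
    PointedMetricSpace.{u} where
  carrier := g.V
  metric :=
    { dist := fun x y => ε * (g.graph.dist x y : ℝ)
      dist_self := fun x => by simp
      dist_comm := fun x y => by simp only [SimpleGraph.dist_comm]
      dist_triangle := fun x y z => by
        rw [← mul_add]
        exact mul_le_mul_of_nonneg_left
          (by exact_mod_cast g.connected.dist_triangle) hε.le
      eq_of_dist_eq_zero := fun {x y} h => by
        have h' : (g.graph.dist x y : ℝ) = 0 := (mul_eq_zero.1 h).resolve_left hε.ne'
        exact g.connected.dist_eq_zero_iff.1 (by exact_mod_cast h') }
  pt := g.root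

/-- `(V, ε d_G, ρ)` converges to `(ℝ, |x - y|, 0)` in the local Gromov-Hausdorff topology as
`ε ↓ 0`. -/
def ConvergesToLine (g : RootedGraph.{u}) : Prop :=
  Tendsto (fun ε : Set.Ioi (0 : ℝ) => dGHloc (g.rescaled ε ε.2) realLine)
    (comap Subtype.val (𝓝[>] (0 : ℝ))) (𝓝 0)

end BSLimit

/-!
The proof is finitary and does not pass through unimodular random graphs or the ergodic theorem.

**Cells of a diametral geodesic.** Let `γ` be a geodesic of length `D = diam G` in a finite graph
`G` with `N ≤ C * D` vertices. Each vertex is assigned to the nearest vertex of `γ`, which partitions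
the graph into `D + 1` cells, whose sizes `w j` sum to `N`. A vertex at distance `h` from `γ` lies in
a cell with more than `h` vertices (`dist_lt_cellCard`), and the ball of radius `r` around `γ i` is
covered by the cells with index within `2 * r` of `i` (`encard_graphBall_le`). Since the average of
`w` is at most `C`, two estimates hold for most vertices of `γ`.
* By the maximal inequality (`mul_card_large_average_le`), all averages of `w` around `i` are at most
  a large constant, for most `i`. Balls around `γ i` then grow linearly.
* For every `m` there is a `k` such that for most `i` one has `m * w j ≤ |i - j| + k` for all `j`
  within a given distance of `i`. Vertices at distance at most `r` from `γ i` are then at distance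
  at most about `r / m` from `γ` (`nearAxis_of_cellCard_le`). The number of exceptional `i` is
  bounded by a truncated tail of `w` (`card_large_value_le`). These tails need not be small uniformly
  in the graph; they are so in the limit along an ultrafilter, because the averages of `min w k` are
  bounded and increase with `k` (`exists_level`).

**Passage to the limit.** The vertices of `γ` make up a proportion of at least `1 / C` of all
vertices. Both estimates up to scale `R` amount to a clopen event `lineEvent` for the local topology,
as they depend on a ball around the root only, so that the limit graph satisfies them up to scale `R`
with probability at least `(1 - δ) / C`, with constants that do not depend on `R`. Intersecting over
`R` and taking the union over `δ = 1 / (q + 1)` gives the event.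

**Geometry of the limit.** On this event, for every `m` there is a `k` such that for every `r` the ball
of radius `r` is within distance `(4 * r + k) / m` of a geodesic of length `2 * r` centred at the
root (`NearAxis`). The evident correspondence between the ball and an interval gives convergence to
the line (`convergesToLine_of_nearAxis`). For the ends, only a small proportional error is needed: of
any three vertices on a large sphere, two are close to each other (`IsLineLike.two_of_three`). Hence
there are at most two infinite components outside a finite set. There are two outside a large ball,
since far from the root no vertex is about as close to one end of a long centred geodesic as to the
other (`dist_endpoints_ne`).
-/

namespace BSLimit

universe u v

/-! ### Local properties of rooted graphs -/

lemma mem_graphBall_iff {V : Type u} {G : SimpleGraph V} (hG : G.Connected) {x y : V} {r : ℕ} :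
    y ∈ graphBall G x r ↔ G.dist x y ≤ r := by
  rw [graphBall, Set.mem_ofPred_eq, ← (hG x y).coe_dist_eq_edist]
  exact_mod_cast Iff.rfl

lemma mem_graphBall_of_mem_support {V : Type u} {G : SimpleGraph V} (hG : G.Connected)
    {o x y z : V} {r : ℕ} (hx : G.dist o x ≤ r) (hy : G.dist o y ≤ r) (p : G.Walk x y)
    (hp : p.length = G.dist x y) (hz : z ∈ p.support) : z ∈ graphBall G o (3 * r) := by
  classical
  rw [mem_graphBall_iff hG]
  have h1 : G.dist x z ≤ p.length :=
    (SimpleGraph.dist_le (p.takeUntil z hz)).trans (p.length_takeUntil_le_length hz)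
  have h2 := hG.dist_triangle (u := o) (v := x) (w := z)
  have h3 := hG.dist_triangle (u := x) (v := o) (w := y)
  rw [G.dist_comm (u := x) (v := o)] at h3
  omega

/-- An isomorphism of balls of radius `3 r` does not increase distances between points of the balls
of radius `r`, since geodesics between such points stay in the larger ball. -/
lemma dist_map_le {g h : RootedGraph.{u}} {r : ℕ}
    (e : g.graph.induce (graphBall g.graph g.root (3 * r)) ≃g
      h.graph.induce (graphBall h.graph h.root (3 * r)))
    (x y : graphBall g.graph g.root (3 * r)) (hx : g.graph.dist g.root x ≤ r)
    (hy : g.graph.dist g.root y ≤ r) :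
    h.graph.dist (e x) (e y) ≤ g.graph.dist (x : g.V) y := by
  obtain ⟨p, hp⟩ := g.connected.exists_walk_length_eq_dist (x : g.V) y
  have hs : ∀ z ∈ p.support, z ∈ graphBall g.graph g.root (3 * r) := fun z hz =>
    mem_graphBall_of_mem_support g.connected hx hy p hp hz
  let q := ((p.induce _ hs).map e.toHom).map (SimpleGraph.Embedding.induce _).toHom
  have hq : q.length = p.length := by
    have h1 : (p.induce _ hs).length = p.length := by
      have := congrArg SimpleGraph.Walk.length (SimpleGraph.Walk.map_induce p hs)
      rwa [SimpleGraph.Walk.length_map] at this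
    simp only [q, SimpleGraph.Walk.length_map, h1]
  rw [← hp, ← hq]
  exact SimpleGraph.dist_le q

/-- The set `A` of rooted graphs depends only on the ball of radius `s` around the root. -/
def DependsOnBall (A : Set RootedGraph.{u}) (s : ℕ) : Prop :=
  ∀ g h, BallIso g h s → g ∈ A → h ∈ A

lemma ballIso_of_dist_lt {g h : RootedGraph.{u}} {s : ℕ} (H : dist g h < (1 / 2 : ℝ) ^ s) :
    BallIso g h s := by
  have H' : dLoc g h < (1 / 2 : ℝ) ^ s := H
  have hs : (s : ℕ∞) < agreeRadius g h := by
    by_contra hle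
    rw [not_lt] at hle
    have hne : agreeRadius g h ≠ ⊤ := ne_top_of_le_ne_top (ENat.natCast_ne_top s) hle
    rw [dLoc, if_neg hne] at H'
    refine absurd H' (not_lt.2 (pow_le_pow_of_le_one (by norm_num) (by norm_num) ?_))
    exact ENat.toNat_le_of_le_natCast hle
  simp only [agreeRadius, lt_iSup_iff] at hs
  obtain ⟨r, hr, hsr⟩ := hs
  exact hr.mono (by exact_mod_cast hsr.le)

lemma DependsOnBall.isOpen {A : Set RootedGraph.{u}} {s : ℕ} (hA : DependsOnBall A s) :
    IsOpen A := by
  refine Metric.isOpen_iff.2 fun g hg => ⟨(1 / 2) ^ s, by positivity, fun h hh => ?_⟩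
  rw [Metric.mem_ball, dist_comm] at hh
  exact hA g h (ballIso_of_dist_lt hh) hg

lemma DependsOnBall.compl {A : Set RootedGraph.{u}} {s : ℕ} (hA : DependsOnBall A s) :
    DependsOnBall Aᶜ s :=
  fun g h H hg hh => hg (hA h g H.symm hh)

lemma DependsOnBall.isClopen {A : Set RootedGraph.{u}} {s : ℕ} (hA : DependsOnBall A s) :
    IsClopen A :=
  ⟨⟨hA.compl.isOpen⟩, hA.isOpen⟩

/-- The ball of radius `r` around the root has at most `l * (r + 1)` vertices. -/
def BallGrowth (g : RootedGraph.{u}) (l r : ℕ) : Prop :=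
  (graphBall g.graph g.root r).encard ≤ (l * (r + 1) : ℕ)

/-- `γ` restricts to a geodesic on the integers of `[-r, r]` which passes through the root at
time zero. Its values outside of this interval are arbitrary. -/
def IsAxis (g : RootedGraph.{u}) (r : ℕ) (γ : ℤ → g.V) : Prop :=
  γ 0 = g.root ∧ ∀ a b : ℤ, |a| ≤ r → |b| ≤ r → (g.graph.dist (γ a) (γ b) : ℤ) = |a - b|

/-- Some geodesic of length `2 r` centred at the root is at distance at most `(4 r + k) / m` from
every vertex of the ball of radius `r`. -/
def NearAxis (g : RootedGraph.{u}) (m k r : ℕ) : Prop :=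
  ∃ γ : ℤ → g.V, IsAxis g r γ ∧ ∀ v, g.graph.dist g.root v ≤ r →
    ∃ a : ℤ, |a| ≤ r ∧ m * g.graph.dist v (γ a) ≤ 4 * r + k

lemma IsAxis.dist_root {g : RootedGraph.{u}} {r : ℕ} {γ : ℤ → g.V} (hγ : IsAxis g r γ) {a : ℤ}
    (ha : |a| ≤ r) : (g.graph.dist g.root (γ a) : ℤ) = |a| := by
  rw [← hγ.1, hγ.2 0 a (by simp) ha, zero_sub, abs_neg]

lemma dependsOnBall_encard_le (b r : ℕ) :
    DependsOnBall {g : RootedGraph.{u} | (graphBall g.graph g.root r).encard ≤ b} r := by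
  rintro g h ⟨e, -⟩ hg
  have : (graphBall h.graph h.root r).encard = (graphBall g.graph g.root r).encard :=
    (Set.encard_congr e.toEquiv).symm
  rw [Set.mem_ofPred_eq, this]
  exact hg

lemma dependsOnBall_ballGrowth (l r : ℕ) :
    DependsOnBall {g : RootedGraph.{u} | BallGrowth g l r} r :=
  dependsOnBall_encard_le _ _

lemma dependsOnBall_nearAxis (m k r : ℕ) :
    DependsOnBall {g : RootedGraph.{u} | NearAxis g m k r} (3 * r) := by
  rintro g h ⟨e, he⟩ ⟨γ, hγ, hv⟩
  have he' : e.symm ⟨h.root, mem_graphBall_self _ _ _⟩ = ⟨g.root, mem_graphBall_self _ _ _⟩ := by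
    rw [← he]; simp
  have sub : ∀ f : RootedGraph.{u}, ∀ x, f.graph.dist f.root x ≤ r →
      x ∈ graphBall f.graph f.root (3 * r) := fun f x hx =>
    (mem_graphBall_iff f.connected).2 (by omega)
  have hroot : ∀ x : graphBall g.graph g.root (3 * r), g.graph.dist g.root x ≤ r →
      h.graph.dist h.root (e x) ≤ r := fun x hx => by
    have := dist_map_le e ⟨g.root, mem_graphBall_self _ _ _⟩ x (by simp) hx
    rw [he] at this
    exact this.trans hx
  have hroot' : ∀ x : graphBall h.graph h.root (3 * r), h.graph.dist h.root x ≤ r →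
      g.graph.dist g.root (e.symm x) ≤ r := fun x hx => by
    have := dist_map_le e.symm ⟨h.root, mem_graphBall_self _ _ _⟩ x (by simp) hx
    rw [he'] at this
    exact this.trans hx
  have heq : ∀ x y : graphBall g.graph g.root (3 * r), g.graph.dist g.root x ≤ r →
      g.graph.dist g.root y ≤ r → h.graph.dist (e x) (e y) = g.graph.dist (x : g.V) y := by
    intro x y hx hy
    refine le_antisymm (dist_map_le e x y hx hy) ?_
    simpa using dist_map_le e.symm (e x) (e y) (hroot x hx) (hroot y hy)
  have hγr : ∀ a : ℤ, |a| ≤ r → g.graph.dist g.root (γ a) ≤ r := fun a ha => by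
    have := hγ.dist_root ha
    omega
  classical
  let δ : ℤ → h.V := fun a => if ha : |a| ≤ r then e ⟨γ a, sub g _ (hγr a ha)⟩ else h.root
  have hδ : ∀ (a : ℤ) (ha : |a| ≤ r), δ a = e ⟨γ a, sub g _ (hγr a ha)⟩ := fun a ha => dif_pos ha
  refine ⟨δ, ⟨?_, fun a b ha hb => ?_⟩, fun v hvr => ?_⟩
  · rw [hδ 0 (by simp)]
    have := congrArg Subtype.val he
    simpa only [hγ.1] using this
  · rw [hδ a ha, hδ b hb, heq _ _ (hγr a ha) (hγr b hb)]
    exact hγ.2 a b ha hb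
  · have h1 := hroot' ⟨v, sub h v hvr⟩ hvr
    obtain ⟨a, ha, h2⟩ := hv _ h1
    refine ⟨a, ha, ?_⟩
    have h3 := heq (e.symm ⟨v, sub h v hvr⟩) ⟨γ a, sub g _ (hγr a ha)⟩ h1 (hγr a ha)
    rw [e.apply_symm_apply] at h3
    rw [hδ a ha, h3]
    exact h2

lemma finite_graphBall (g : RootedGraph.{u}) (r : ℕ) : (graphBall g.graph g.root r).Finite := by
  induction r with
  | zero =>
    refine (Set.finite_singleton g.root).subset fun x hx => ?_
    rw [mem_graphBall_iff g.connected, Nat.le_zero, g.connected.dist_eq_zero_iff] at hx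
    exact hx.symm
  | succ r ih =>
    refine ((Set.finite_singleton g.root).union
      (ih.biUnion fun x _ => g.locallyFinite x)).subset fun x hx => ?_
    rw [mem_graphBall_iff g.connected] at hx
    obtain ⟨p, hp⟩ := g.connected.exists_walk_length_eq_dist g.root x
    by_cases hn : p.Nil
    · exact Or.inl hn.eq.symm
    · refine Or.inr (Set.mem_biUnion (x := p.penultimate) ?_ (p.adj_penultimate hn))
      rw [mem_graphBall_iff g.connected]
      have h1 := SimpleGraph.dist_le p.dropLast
      have h2 := SimpleGraph.Walk.length_dropLast_add_one hn
      omega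

/-- A vertex at distance at least `s` from `o` lies behind a vertex at distance exactly `s`. -/
lemma exists_dist_eq {V : Type u} {G : SimpleGraph V} (hG : G.Connected) {o x : V} {s : ℕ}
    (hs : s ≤ G.dist o x) : ∃ y, G.dist o y = s ∧ G.dist o x = s + G.dist y x := by
  obtain ⟨p, hp⟩ := hG.exists_walk_length_eq_dist o x
  refine ⟨p.getVert s, ?_⟩
  have h1 := SimpleGraph.dist_le (p.take s)
  have h2 := SimpleGraph.dist_le (p.drop s)
  rw [SimpleGraph.Walk.take_length] at h1
  rw [SimpleGraph.Walk.drop_length] at h2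
  have h3 := hG.dist_triangle (u := o) (v := p.getVert s) (w := x)
  have := min_le_left s p.length
  omega

/-! ### Convergence to the line -/

lemma dGH_le_of_distortion {X : PointedMetricSpace.{u}} {Y : PointedMetricSpace.{v}}
    {R : Set (X.carrier × Y.carrier)} (hR : IsCorrespondence X Y R) {c : ℝ}
    (hc : ∀ p ∈ R, ∀ q ∈ R, |X.d p.1 q.1 - Y.d p.2 q.2| ≤ 2 * c) :
    dGH X Y ≤ ENNReal.ofReal c := by
  have h1 : distortion X Y R ≤ ENNReal.ofReal (2 * c) :=
    iSup₂_le fun p hp => iSup₂_le fun q hq => ENNReal.ofReal_le_ofReal (hc p hp q hq)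
  calc dGH X Y ≤ (1 / 2) * distortion X Y R := by
        unfold dGH
        gcongr
        exact iInf₂_le R hR
    _ ≤ (1 / 2) * ENNReal.ofReal (2 * c) := by gcongr
    _ = ENNReal.ofReal c := by
        have : (1 / 2 : ℝ≥0∞) = ENNReal.ofReal (1 / 2) := by
          rw [ENNReal.ofReal_div_of_pos (by norm_num)]; simp
        rw [this, ← ENNReal.ofReal_mul (by norm_num)]
        congr 1; ring

lemma dGH_rescaled_closedBall_le {g : RootedGraph.{u}} {ε : ℝ} (hε : 0 < ε) {r : ℝ} (hr : 0 ≤ r)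
    (Rel : g.V → ℝ → Prop) {c : ℝ}
    (h1 : ∀ x, ε * g.graph.dist g.root x ≤ r → ∃ t : ℝ, |t| ≤ r ∧ Rel x t)
    (h2 : ∀ t : ℝ, |t| ≤ r → ∃ x, ε * g.graph.dist g.root x ≤ r ∧ Rel x t)
    (h3 : Rel g.root 0)
    (h4 : ∀ x t y u, Rel x t → Rel y u → |ε * g.graph.dist x y - (|t - u|)| ≤ 2 * c) :
    dGH ((g.rescaled ε hε).closedBall r hr) (realLine.closedBall r hr) ≤ ENNReal.ofReal c := by
  let R : Set (((g.rescaled ε hε).closedBall r hr).carrier × (realLine.closedBall r hr).carrier) :=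
    {p | Rel p.1.1 p.2.1}
  have hd : ∀ x : g.V, ε * (g.graph.dist x g.root : ℝ) ≤ r ↔ ε * g.graph.dist g.root x ≤ r :=
    fun x => by rw [SimpleGraph.dist_comm]
  have hd' : ∀ t : ℝ, |t - 0| ≤ r ↔ |t| ≤ r := fun t => by rw [sub_zero]
  refine dGH_le_of_distortion (R := R) ⟨?_, ?_, h3⟩ ?_
  · rintro ⟨x, hx⟩
    obtain ⟨t, ht, h⟩ := h1 x ((hd x).1 hx)
    exact ⟨⟨t, (hd' t).2 ht⟩, h⟩
  · rintro ⟨t, ht⟩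
    obtain ⟨x, hx, h⟩ := h2 t ((hd' t).1 ht)
    exact ⟨⟨x, (hd x).2 hx⟩, h⟩
  · rintro ⟨⟨x, hx⟩, ⟨t, ht⟩⟩ h ⟨⟨y, hy⟩, ⟨u, hu⟩⟩ h'
    exact h4 x t y u h h'

lemma abs_cast_dist_sub_le {g : RootedGraph.{u}} {r : ℕ} {γ : ℤ → g.V} (hγ : IsAxis g r γ)
    {x y : g.V} {a b : ℤ} (ha : |a| ≤ r) (hb : |b| ≤ r) :
    |(g.graph.dist x y : ℝ) - (|(a : ℝ) - b|)|
      ≤ g.graph.dist x (γ a) + g.graph.dist y (γ b) := by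
  have h1 := g.connected.dist_triangle (u := x) (v := γ a) (w := y)
  have h2 := g.connected.dist_triangle (u := γ a) (v := γ b) (w := y)
  have h3 := g.connected.dist_triangle (u := γ a) (v := x) (w := γ b)
  have h4 := g.connected.dist_triangle (u := x) (v := y) (w := γ b)
  have h5 := hγ.2 a b ha hb
  rw [g.graph.dist_comm (u := γ b) (v := y)] at h2
  rw [g.graph.dist_comm (u := γ a) (v := x)] at h3
  have h6 : (g.graph.dist (γ a) (γ b) : ℝ) = |(a : ℝ) - b| := by exact_mod_cast h5
  rw [← h6, abs_le]
  constructor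
  · have : (g.graph.dist (γ a) (γ b) : ℝ) ≤
      g.graph.dist x (γ a) + (g.graph.dist x y + g.graph.dist y (γ b)) := by
      exact_mod_cast (by omega)
    linarith
  · have : (g.graph.dist x y : ℝ) ≤
      g.graph.dist x (γ a) + (g.graph.dist (γ a) (γ b) + g.graph.dist y (γ b)) := by
      exact_mod_cast (by omega)
    linarith

/-- The correspondence relates a vertex `x` and a real `t` whenever `x` is close to `γ a` and `t`
is close to `ε * a`, for a common `a`. -/
lemma dGH_closedBall_le {g : RootedGraph.{u}} {m k : ℕ} (hm : 0 < m) (hg : ∀ r, NearAxis g m k r)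
    {ε : ℝ} (hε : 0 < ε) {r : ℝ} (hr : 0 ≤ r) :
    dGH ((g.rescaled ε hε).closedBall r hr) (realLine.closedBall r hr)
      ≤ ENNReal.ofReal ((4 * r + ε * k) / m + ε) := by
  set s := ⌊r / ε⌋₊ with hs
  have hm' : (0 : ℝ) < m := by exact_mod_cast hm
  have hs1 : ε * s ≤ r := by
    have := Nat.floor_le (a := r / ε) (by positivity)
    rwa [← hs, le_div_iff₀ hε, mul_comm] at this
  have hs2 : ∀ n : ℕ, ε * n ≤ r → n ≤ s := fun n hn => by
    refine Nat.le_floor ?_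
    rwa [le_div_iff₀ hε, mul_comm]
  obtain ⟨γ, hγ, hv⟩ := hg s
  have hscale : ∀ a : ℤ, |a| ≤ s → ε * |(a : ℝ)| ≤ r := fun a ha => by
    have : |(a : ℝ)| ≤ s := by exact_mod_cast ha
    exact (mul_le_mul_of_nonneg_left this hε.le).trans hs1
  refine dGH_rescaled_closedBall_le hε hr
    (fun x t => ∃ a : ℤ, |a| ≤ s ∧ m * g.graph.dist x (γ a) ≤ 4 * s + k ∧ |t - ε * a| ≤ ε)
    ?_ ?_ ?_ ?_
  · intro x hx
    obtain ⟨a, ha, h1⟩ := hv x (hs2 _ hx)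
    refine ⟨ε * a, ?_, a, ha, h1, ?_⟩
    · rw [abs_mul, abs_of_pos hε]
      exact hscale a ha
    · simpa using hε.le
  · -- rounding `t / ε` towards zero keeps the integer in `[-s, s]`
    have key : ∀ t : ℝ, 0 ≤ t → t ≤ r → ∃ a : ℤ, |a| ≤ s ∧ |t - ε * a| ≤ ε := by
      intro t h0 h1
      have h2 := Nat.floor_le (a := t / ε) (by positivity)
      have h3 := Nat.lt_floor_add_one (t / ε)
      have h4 : ⌊t / ε⌋₊ ≤ s := Nat.floor_mono (by gcongr)
      rw [le_div_iff₀ hε] at h2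
      rw [div_lt_iff₀ hε] at h3
      refine ⟨(⌊t / ε⌋₊ : ℕ), by rw [Nat.abs_cast]; exact_mod_cast h4, ?_⟩
      rw [abs_le, Int.cast_natCast]
      constructor <;> linarith
    intro t ht
    obtain ⟨a, ha, hta⟩ : ∃ a : ℤ, |a| ≤ s ∧ |t - ε * a| ≤ ε := by
      rcases le_total 0 t with h0 | h0
      · exact key t h0 (le_of_abs_le ht)
      · obtain ⟨a, ha, hta⟩ := key (-t) (by linarith) (by linarith [neg_le_of_abs_le ht])
        refine ⟨-a, by rwa [abs_neg], ?_⟩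
        rw [← abs_neg]
        push_cast
        convert hta using 2
        ring
    refine ⟨γ a, ?_, a, ha, by simp, hta⟩
    have : (g.graph.dist g.root (γ a) : ℝ) = |(a : ℝ)| := by exact_mod_cast hγ.dist_root ha
    rw [this]
    exact hscale a ha
  · exact ⟨0, by simp, by simp [hγ.1], by simpa using hε.le⟩
  · rintro x t y u ⟨a, ha, h1, h2⟩ ⟨b, hb, h3, h4⟩
    have hbd : ∀ d : ℕ, m * d ≤ 4 * s + k → ε * (d : ℝ) ≤ (4 * r + ε * k) / m := by
      intro d hd
      have hd' : (m : ℝ) * d ≤ 4 * s + k := by exact_mod_cast hd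
      rw [le_div_iff₀ hm']
      nlinarith [mul_le_mul_of_nonneg_left hd' hε.le]
    have h5 := abs_cast_dist_sub_le hγ (x := x) (y := y) ha hb
    have h6 : |ε * (g.graph.dist x y : ℝ) - (|ε * a - ε * b|)| ≤ 2 * ((4 * r + ε * k) / m) := by
      rw [← mul_sub, abs_mul, abs_of_pos hε, ← mul_sub, abs_mul, abs_of_pos hε]
      have := mul_le_mul_of_nonneg_left h5 hε.le
      rw [mul_add] at this
      linarith [hbd _ h1, hbd _ h3]
    have h7 : |(|ε * a - ε * b|) - (|t - u|)| ≤ 2 * ε := by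
      refine (abs_abs_sub_abs_le _ _).trans ?_
      rw [abs_le] at h2 h4 ⊢
      constructor <;> linarith [h2.1, h2.2, h4.1, h4.2]
    have := abs_sub_le (ε * (g.graph.dist x y : ℝ)) (|ε * a - ε * b|) (|t - u|)
    linarith

lemma dGHloc_le {g : RootedGraph.{u}} {m k : ℕ} (hm : 0 < m) (hg : ∀ r, NearAxis g m k r)
    {ε : ℝ} (hε : 0 < ε) :
    dGHloc (g.rescaled ε hε) realLine ≤ ENNReal.ofReal (8 / m + ε * (k + 1)) := by
  have hm' : (1 : ℝ) ≤ m := by exact_mod_cast hm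
  have hc : (4 * (0 : ℝ) + ε * k) / m ≤ ε * k := by
    rw [mul_zero, zero_add]
    exact div_le_self (by positivity) hm'
  have h1 : HasSum (fun r : ℕ => (1 / 2 : ℝ) ^ (r + 1)) 1 := by
    have h := hasSum_geometric_two.mul_left (1 / 2 : ℝ)
    rw [show (1 / 2 : ℝ) * 2 = 1 by norm_num] at h
    simpa only [pow_succ'] using h
  have h2 : HasSum (fun r : ℕ => (1 / 2 : ℝ) ^ (r + 1) * ((r : ℝ) + 1)) 2 := by
    have h3 := ((hasSum_coe_mul_geometric_of_norm_lt_one (r := (1 / 2 : ℝ)) (by norm_num)).mul_left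
      (1 / 2 : ℝ)).add h1
    rw [show (1 / 2 : ℝ) * (1 / 2 / (1 - 1 / 2) ^ 2) + 1 = 2 by norm_num] at h3
    refine h3.congr_fun fun r => ?_
    ring
  have h3 := (h2.mul_left (4 / (m : ℝ))).add (h1.mul_left (ε * (k + 1)))
  have h4 : ∀ r : ℕ, (0 : ℝ) ≤ 4 / m * ((1 / 2 : ℝ) ^ (r + 1) * ((r : ℝ) + 1)) +
      ε * (k + 1) * (1 / 2 : ℝ) ^ (r + 1) := fun r => by positivity
  have h5 := ENNReal.ofReal_tsum_of_nonneg h4 h3.summable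
  rw [h3.tsum_eq, show 4 / (m : ℝ) * 2 + ε * (k + 1) * 1 = 8 / m + ε * (k + 1) by ring] at h5
  rw [h5, dGHloc]
  refine ENNReal.tsum_le_tsum fun r => ?_
  have h6 : (1 / 2 : ℝ≥0∞) = ENNReal.ofReal (1 / 2) := by
    rw [ENNReal.ofReal_div_of_pos (by norm_num)]; simp
  calc _ ≤ (1 / 2 : ℝ≥0∞) ^ (r + 1) * ENNReal.ofReal ((4 * ((r : ℝ) + 1) + ε * k) / m + ε) := by
        gcongr
        exact dGH_closedBall_le hm hg hε _
    _ = ENNReal.ofReal ((1 / 2) ^ (r + 1) * ((4 * ((r : ℝ) + 1) + ε * k) / m + ε)) := by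
        rw [h6, ← ENNReal.ofReal_pow (by norm_num), ← ENNReal.ofReal_mul (by positivity)]
    _ ≤ _ := by
        refine ENNReal.ofReal_le_ofReal ?_
        have h7 : (4 * ((r : ℝ) + 1) + ε * k) / m ≤ 4 / m * ((r : ℝ) + 1) + ε * k := by
          have : (4 * ((r : ℝ) + 1) + ε * k) / m = 4 / m * ((r : ℝ) + 1) + (4 * 0 + ε * k) / m := by
            ring
          rw [this]
          linarith
        have h8 : (0 : ℝ) ≤ (1 / 2) ^ (r + 1) := by positivity
        nlinarith [mul_le_mul_of_nonneg_left h7 h8]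

/-- If at every scale the balls stay close, on the scale of their radius, to a geodesic centred at
the root, then the rescaled graph converges to the line. -/
lemma convergesToLine_of_nearAxis {g : RootedGraph.{u}}
    (hg : ∀ m : ℕ, ∃ k, ∀ r, NearAxis g (m + 1) k r) : ConvergesToLine g := by
  rw [ConvergesToLine, ENNReal.tendsto_nhds_zero]
  intro η hη
  obtain ⟨c, hc0, hcη⟩ : ∃ c : ℝ, 0 < c ∧ ENNReal.ofReal c ≤ η := by
    rcases eq_or_ne η ⊤ with rfl | h
    · exact ⟨1, one_pos, le_top⟩
    · exact ⟨η.toReal, ENNReal.toReal_pos hη.ne' h, ENNReal.ofReal_toReal_le⟩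
  -- both `8 / (m + 1)` and `ε * (k + 1)` are made smaller than `c / 2`
  obtain ⟨m, hm⟩ := exists_nat_gt (16 / c)
  obtain ⟨k, hk⟩ := hg m
  have h0 : ∀ᶠ ε in 𝓝[>] (0 : ℝ), ε < c / (2 * (k + 1)) := by
    refine nhdsWithin_le_nhds (gt_mem_nhds ?_)
    positivity
  filter_upwards [preimage_mem_comap h0] with ε hε
  have hε' : (ε : ℝ) < c / (2 * (k + 1)) := hε
  refine (dGHloc_le (Nat.succ_pos m) hk ε.2).trans (le_trans (ENNReal.ofReal_le_ofReal ?_) hcη)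
  rw [lt_div_iff₀ (by positivity)] at hε'
  have h1 : 8 / ((m + 1 : ℕ) : ℝ) ≤ c / 2 := by
    rw [div_lt_iff₀ hc0] at hm
    push_cast
    rw [div_le_iff₀ (by positivity)]
    nlinarith
  linarith

/-! ### Ends and growth of graphs close to a line -/

/-- A centred geodesic of length `2 r` comes within distance `r / 10` of all vertices of the ball of
radius `r`. This single-scale form of closeness to a line is what the count of ends needs. -/
def IsLineLike (g : RootedGraph.{u}) (r : ℕ) : Prop :=
  ∃ γ : ℤ → g.V, IsAxis g r γ ∧ ∀ v, g.graph.dist g.root v ≤ r →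
    ∃ a : ℤ, |a| ≤ r ∧ 10 * g.graph.dist v (γ a) ≤ r

lemma exists_forall_isLineLike {g : RootedGraph.{u}} {k : ℕ} (hg : ∀ r, NearAxis g 50 k r) :
    ∀ r, k ≤ r → IsLineLike g r := by
  intro r hr
  obtain ⟨γ, hγ, hv⟩ := hg r
  refine ⟨γ, hγ, fun v hvr => ?_⟩
  obtain ⟨a, ha, h⟩ := hv v hvr
  exact ⟨a, ha, by omega⟩

/-- Every vertex of the sphere is close to one of the two endpoints of the geodesic, so that of
three vertices of the sphere two are close to each other. -/
lemma IsLineLike.two_of_three {g : RootedGraph.{u}} {s : ℕ} (hg : IsLineLike g s) {x y z : g.V}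
    (hx : g.graph.dist g.root x = s) (hy : g.graph.dist g.root y = s)
    (hz : g.graph.dist g.root z = s) :
    10 * g.graph.dist x y ≤ 3 * s ∨ 10 * g.graph.dist x z ≤ 3 * s ∨
      10 * g.graph.dist y z ≤ 3 * s := by
  obtain ⟨γ, hγ, hv⟩ := hg
  have side : ∀ v, g.graph.dist g.root v = s → ∃ a : ℤ, |a| ≤ s ∧ 9 * s ≤ 10 * |a| ∧
      10 * g.graph.dist v (γ a) ≤ s := by
    intro v hvs
    obtain ⟨a, ha, h⟩ := hv v hvs.le
    refine ⟨a, ha, ?_, h⟩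
    have h1 := hγ.dist_root ha
    have h2 := g.connected.dist_triangle (u := g.root) (v := γ a) (w := v)
    rw [g.graph.dist_comm (u := γ a)] at h2
    omega
  have close : ∀ v w (a b : ℤ), |a| ≤ s → |b| ≤ s → 10 * |a - b| ≤ s →
      10 * g.graph.dist v (γ a) ≤ s → 10 * g.graph.dist w (γ b) ≤ s →
      10 * g.graph.dist v w ≤ 3 * s := by
    intro v w a b ha hb hab h1 h2
    have h3 := hγ.2 a b ha hb
    have h4 := g.connected.dist_triangle (u := v) (v := γ a) (w := w)
    have h5 := g.connected.dist_triangle (u := γ a) (v := γ b) (w := w)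
    rw [g.graph.dist_comm (u := γ b)] at h5
    omega
  obtain ⟨a, ha, ha', hxa⟩ := side x hx
  obtain ⟨b, hb, hb', hyb⟩ := side y hy
  obtain ⟨c, hc, hc', hzc⟩ := side z hz
  have h : 10 * |a - b| ≤ s ∨ 10 * |a - c| ≤ s ∨ 10 * |b - c| ≤ s := by
    simp only [abs_eq_max_neg] at *
    omega
  rcases h with h | h | h
  · exact Or.inl (close x y a b ha hb h hxa hyb)
  · exact Or.inr (Or.inl (close x z a c ha hc h hxa hzc))
  · exact Or.inr (Or.inr (close y z b c hb hc h hyb hzc))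

lemma mem_componentCompl_of_walk {V : Type u} {G : SimpleGraph V} {K : Set V}
    {D : G.ComponentCompl K} {x y : V} (p : G.Walk x y) (hp : ∀ z ∈ p.support, z ∉ K)
    (hx : x ∈ D) : y ∈ D := by
  induction p with
  | nil => exact hx
  | cons hadj q ih =>
    refine ih (fun z hz => hp z (by simp [hz])) ?_
    exact SimpleGraph.ComponentCompl.mem_of_adj _ _ hx (hp _ (by simp)) hadj

/-- A geodesic from `x` which is too short to reach the ball of radius `t` around the root stays in
the component of `x`. -/
lemma mem_componentCompl_of_dist {g : RootedGraph.{u}} {K : Set g.V} {t : ℕ}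
    (hK : ∀ z ∈ K, g.graph.dist g.root z ≤ t) {D : g.graph.ComponentCompl K} {x y : g.V}
    (hxy : t + g.graph.dist x y < g.graph.dist g.root x) (hx : x ∈ D) : y ∈ D := by
  classical
  obtain ⟨p, hp⟩ := g.connected.exists_walk_length_eq_dist x y
  refine mem_componentCompl_of_walk p (fun z hz hzK => ?_) hx
  have h1 := (SimpleGraph.dist_le (p.takeUntil z hz)).trans (p.length_takeUntil_le_length hz)
  have h2 := hK z hzK
  have h3 := g.connected.dist_triangle (u := g.root) (v := z) (w := x)
  rw [g.graph.dist_comm (u := z)] at h3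
  omega

/-- A geodesic from `x` to the root meets the sphere of radius `s > t` before the ball of
radius `t`. -/
lemma mem_componentCompl_of_dist_add {g : RootedGraph.{u}} {K : Set g.V} {t s : ℕ}
    (hK : ∀ z ∈ K, g.graph.dist g.root z ≤ t) (hts : t < s) {D : g.graph.ComponentCompl K}
    {x y : g.V} (hy : g.graph.dist g.root y = s)
    (hxy : g.graph.dist g.root x = s + g.graph.dist y x) (hx : x ∈ D) : y ∈ D := by
  refine mem_componentCompl_of_dist hK ?_ hx
  rw [g.graph.dist_comm (u := x)]
  omega

lemma exists_bound_of_finite (g : RootedGraph.{u}) {K : Set g.V} (hK : K.Finite) :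
    ∃ t, ∀ z ∈ K, g.graph.dist g.root z ≤ t := by
  obtain ⟨t, ht⟩ := (hK.image fun z => g.graph.dist g.root z).bddAbove
  exact ⟨t, fun z hz => ht ⟨z, hz, rfl⟩⟩

lemma exists_lt_dist_of_infinite (g : RootedGraph.{u}) {A : Set g.V} (hA : A.Infinite) (s : ℕ) :
    ∃ x ∈ A, s < g.graph.dist g.root x := by
  by_contra! h
  exact hA ((finite_graphBall g s).subset fun x hx => (mem_graphBall_iff g.connected).2 (h x hx))

lemma encard_infinite_components_le_two {g : RootedGraph.{u}} {k : ℕ}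
    (hg : ∀ r, k ≤ r → IsLineLike g r) (K : Finset g.V) :
    Set.encard {D : g.graph.ComponentCompl (K : Set g.V) | D.supp.Infinite} ≤ 2 := by
  obtain ⟨t, ht⟩ := exists_bound_of_finite g K.finite_toSet
  set s := k + 2 * t + 1 with hs
  have key : ∀ D : g.graph.ComponentCompl (K : Set g.V), D.supp.Infinite →
      ∃ x ∈ D, g.graph.dist g.root x = s := by
    intro D hD
    obtain ⟨x, hx, hsx⟩ := exists_lt_dist_of_infinite g hD s
    obtain ⟨y, hy, hyx⟩ := exists_dist_eq g.connected hsx.le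
    exact ⟨y, mem_componentCompl_of_dist_add ht (by omega) hy hyx hx, hy⟩
  have join : ∀ (D E : g.graph.ComponentCompl (K : Set g.V)) (x y : g.V), x ∈ D → y ∈ E →
      g.graph.dist g.root x = s → 10 * g.graph.dist x y ≤ 3 * s → D = E := by
    intro D E x y hx hy hxs hxy
    have hyD : y ∈ D := mem_componentCompl_of_dist ht (by omega) hx
    by_contra hne
    exact Set.disjoint_left.1 (SimpleGraph.ComponentCompl.pairwise_disjoint hne) hyD hy
  by_contra h
  obtain ⟨A, hA, hA3⟩ := Set.exists_subset_encard_eq (k := 3) (by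
    rw [show (3 : ℕ∞) = 2 + 1 by norm_num]
    exact Order.add_one_le_of_lt (not_le.1 h))
  obtain ⟨D, E, F, hDE, hDF, hEF, rfl⟩ := Set.encard_eq_three.1 hA3
  have hD : D.supp.Infinite := hA (by simp)
  have hE : E.supp.Infinite := hA (by simp)
  have hF : F.supp.Infinite := hA (by simp)
  obtain ⟨x, hx, hxs⟩ := key D hD
  obtain ⟨y, hy, hys⟩ := key E hE
  obtain ⟨z, hz, hzs⟩ := key F hF
  rcases (hg s (by omega)).two_of_three hxs hys hzs with h | h | h
  · exact hDE (join D E x y hx hy hxs h)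
  · exact hDF (join D F x z hx hz hxs h)
  · exact hEF (join E F y z hy hz hys h)

/-- Far from the root, no vertex is about as close to one end of a long centred geodesic as to the
other. -/
lemma dist_endpoints_ne {g : RootedGraph.{u}} {s M : ℕ} (hg : IsLineLike g s) (hs : 3 ≤ s)
    (hsM : s ≤ M) {γ : ℤ → g.V} (hγ : IsAxis g M γ) {v : g.V} (hv : g.graph.dist g.root v = s) :
    g.graph.dist v (γ M) + 3 ≤ g.graph.dist v (γ (-M)) ∨
      g.graph.dist v (γ (-M)) + 3 ≤ g.graph.dist v (γ M) := by
  have hM : |(M : ℤ)| ≤ M := by simp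
  have hM' : |(-M : ℤ)| ≤ M := by simp
  have h1 : |(s : ℤ)| ≤ M := by simpa using hsM
  have h2 : |(-s : ℤ)| ≤ M := by simpa using hsM
  have d1 := hγ.dist_root h1
  have d2 := hγ.dist_root h2
  have e0 := hγ.2 _ _ h1 h2
  have e1 := hγ.2 _ _ h1 hM
  have e2 := hγ.2 _ _ h1 hM'
  have e3 := hγ.2 _ _ h2 hM
  have e4 := hγ.2 _ _ h2 hM'
  rw [abs_neg, Nat.abs_cast] at d2
  rw [Nat.abs_cast] at d1
  have t1 := g.connected.dist_triangle (u := v) (v := γ s) (w := γ M)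
  have t2 := g.connected.dist_triangle (u := γ s) (v := v) (w := γ (-M))
  have t3 := g.connected.dist_triangle (u := v) (v := γ (-s)) (w := γ (-M))
  have t4 := g.connected.dist_triangle (u := γ (-s)) (v := v) (w := γ M)
  rw [g.graph.dist_comm (v := v)] at t2 t4
  simp only [abs_eq_max_neg] at e0 e1 e2 e3 e4
  rcases hg.two_of_three hv (x := v) (y := γ s) (z := γ (-s)) (by omega) (by omega) with h | h | h
  · left; omega
  · right; omega
  · omega

/-- A walk that stays away from the root cannot lead from one side of a long centred geodesic to the
other. -/
lemma dist_endpoints_lt_of_walk {g : RootedGraph.{u}} {k M : ℕ}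
    (hg : ∀ r, k ≤ r → IsLineLike g r) (hk : 3 ≤ k) {γ : ℤ → g.V} (hγ : IsAxis g M γ) {x y : g.V}
    (p : g.graph.Walk x y)
    (hp : ∀ z ∈ p.support, k ≤ g.graph.dist g.root z ∧ g.graph.dist g.root z ≤ M)
    (hx : g.graph.dist x (γ M) < g.graph.dist x (γ (-M))) :
    g.graph.dist y (γ M) < g.graph.dist y (γ (-M)) := by
  induction p with
  | nil => exact hx
  | @cons a b c hadj q ih =>
    refine ih (fun z hz => hp z (by simp [hz])) ?_
    obtain ⟨h1, h2⟩ := hp a (by simp)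
    have h3 := dist_endpoints_ne (hg _ h1) (hk.trans h1) h2 hγ rfl
    have h4 : g.graph.dist a b = 1 := SimpleGraph.dist_eq_one_iff_adj.2 hadj
    have t1 := g.connected.dist_triangle (u := b) (v := a) (w := γ M)
    have t2 := g.connected.dist_triangle (u := a) (v := b) (w := γ (-M))
    rw [g.graph.dist_comm (u := b) (v := a)] at t1
    omega

lemma two_le_encard_infinite_components {g : RootedGraph.{u}} {k : ℕ}
    (hg : ∀ r, k ≤ r → IsLineLike g r) (hk : 3 ≤ k) :
    2 ≤ Set.encard {D : g.graph.ComponentCompl ((finite_graphBall g k).toFinset : Set g.V) |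
      D.supp.Infinite} := by
  set K : Set g.V := ((finite_graphBall g k).toFinset : Set g.V) with hKdef
  have hK : ∀ z, z ∈ K ↔ g.graph.dist g.root z ≤ k := fun z => by
    rw [hKdef, Set.Finite.coe_toFinset, mem_graphBall_iff g.connected]
  have : Nonempty g.V := ⟨g.root⟩
  choose! γ hγ hγ' using hg
  -- the pairs of vertices at which the geodesics leave the ball form a finite set, so that one
  -- pair occurs for arbitrarily long geodesics
  have hfin : ((graphBall g.graph g.root (k + 1)) ×ˢ (graphBall g.graph g.root (k + 1))).Finite :=
    (finite_graphBall g (k + 1)).prod (finite_graphBall g (k + 1))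
  have hd : ∀ M : ℕ, k < M → ∀ a : ℤ, |a| ≤ M → (g.graph.dist g.root (γ M a) : ℤ) = |a| :=
    fun M hM a ha => (hγ M hM.le).dist_root ha
  obtain ⟨⟨x, y⟩, hxy⟩ : ∃ q : g.V × g.V, ∃ᶠ M : ℕ in atTop, k < M ∧
      (γ M (k + 1), γ M (-(k + 1))) = q := by
    by_contra h
    simp only [not_exists, not_frequently] at h
    have := (Filter.eventually_all_finite hfin).2 fun q _ => h q
    obtain ⟨M, hM, hM'⟩ := (this.and (eventually_gt_atTop k)).exists
    have h1 := hd M hM' (k + 1) (by rw [abs_of_nonneg] <;> omega)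
    have h2 := hd M hM' (-(k + 1)) (by rw [abs_neg, abs_of_nonneg] <;> omega)
    rw [abs_of_nonneg (by omega)] at h1
    rw [abs_neg, abs_of_nonneg (by omega)] at h2
    refine hM (γ M (k + 1), γ M (-(k + 1))) ⟨?_, ?_⟩ ⟨hM', rfl⟩ <;>
    · rw [mem_graphBall_iff g.connected]
      dsimp only
      omega
  have hfreq : ∀ n : ℕ, ∃ M, n ≤ M ∧ k < M ∧ γ M (k + 1) = x ∧ γ M (-(k + 1)) = y := fun n => by
    obtain ⟨M, ⟨h1, h2⟩, h3⟩ := (hxy.and_eventually (eventually_ge_atTop n)).exists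
    rw [Prod.mk.injEq] at h2
    exact ⟨M, h3, h1, h2.1, h2.2⟩
  -- the rest of such a geodesic lies in a single component, on either side
  have hout : ∀ (M : ℕ) (σ : ℤ), k < M → (σ = 1 ∨ σ = -1) → ∀ D : g.graph.ComponentCompl K,
      γ M (σ * (k + 1)) ∈ D → γ M (σ * M) ∈ D := by
    intro M σ hM hσ D hD
    have key : ∀ j : ℕ, k + 1 + j ≤ M → γ M (σ * (k + 1 + j)) ∈ D := by
      intro j
      induction j with
      | zero => intro _; simpa using hD
      | succ j ih =>
        intro hj
        have hb1 : |σ * (k + 1 + j)| = k + 1 + j := by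
          rcases hσ with rfl | rfl
          · rw [one_mul, abs_of_nonneg (by omega)]
          · rw [neg_one_mul, abs_neg, abs_of_nonneg (by omega)]
        have hb2 : |σ * (k + 1 + (j + 1 : ℕ))| = k + 1 + (j + 1 : ℕ) := by
          rcases hσ with rfl | rfl
          · rw [one_mul, abs_of_nonneg (by omega)]
          · rw [neg_one_mul, abs_neg, abs_of_nonneg (by omega)]
        refine SimpleGraph.ComponentCompl.mem_of_adj _ _ (ih (by omega)) ?_ ?_
        · rw [hK]
          have := hd M hM _ (hb2.trans_le (by omega))
          omega
        · rw [← SimpleGraph.dist_eq_one_iff_adj]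
          have := (hγ M hM.le).2 _ _ (hb1.trans_le (by omega)) (hb2.trans_le (by omega))
          have hone : |σ * (k + 1 + j) - σ * (k + 1 + (j + 1 : ℕ))| = 1 := by
            rcases hσ with rfl | rfl <;> simp only [abs_eq_max_neg] <;> omega
          rw [hone] at this
          exact_mod_cast this
    have := key (M - (k + 1)) (by omega)
    rwa [show (k + 1 + (M - (k + 1) : ℕ) : ℤ) = M by omega] at this
  obtain ⟨M₁, -, hM₁, hx₁, hy₁⟩ := hfreq 0
  have hxK : x ∉ K := by
    rw [hK, ← hx₁]
    have := hd M₁ hM₁ (k + 1) (by rw [abs_of_nonneg] <;> omega)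
    rw [abs_of_nonneg (by omega)] at this
    omega
  have hyK : y ∉ K := by
    rw [hK, ← hy₁]
    have := hd M₁ hM₁ (-(k + 1)) (by rw [abs_neg, abs_of_nonneg] <;> omega)
    rw [abs_neg, abs_of_nonneg (by omega)] at this
    omega
  have hinf : ∀ (z : g.V) (hz : z ∉ K) (σ : ℤ), (σ = 1 ∨ σ = -1) →
      (∀ n : ℕ, ∃ M, n ≤ M ∧ k < M ∧ γ M (σ * (k + 1)) = z) →
      (g.graph.componentComplMk hz).supp.Infinite := by
    intro z hz σ hσ hzf hfin
    obtain ⟨t, ht⟩ := exists_bound_of_finite g hfin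
    obtain ⟨M, hM, hkM, hMz⟩ := hzf (t + 1)
    have h1 := hout M σ hkM hσ (g.graph.componentComplMk hz)
      (by rw [hMz]; exact SimpleGraph.componentComplMk_mem g.graph hz)
    have h2 := ht _ h1
    have h3 : |σ * (M : ℤ)| = M := by rcases hσ with rfl | rfl <;> simp
    have h4 := hd M hkM _ h3.le
    omega
  have hx_inf := hinf x hxK 1 (Or.inl rfl) fun n => by
    obtain ⟨M, h1, h2, h3, -⟩ := hfreq n
    exact ⟨M, h1, h2, by rwa [one_mul]⟩
  have hy_inf := hinf y hyK (-1) (Or.inr rfl) fun n => by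
    obtain ⟨M, h1, h2, -, h3⟩ := hfreq n
    exact ⟨M, h1, h2, by rwa [neg_one_mul]⟩
  have hne : g.graph.componentComplMk hxK ≠ g.graph.componentComplMk hyK := by
    intro heq
    obtain ⟨w⟩ := SimpleGraph.ConnectedComponent.exact heq
    let p : g.graph.Walk x y := w.map (SimpleGraph.Embedding.induce Kᶜ).toHom
    have hp : ∀ z ∈ p.support, z ∉ K := by
      intro z hz
      have hz' := (SimpleGraph.Walk.support_map _ w).subst hz
      obtain ⟨z', -, rfl⟩ := List.mem_map.1 hz'
      exact z'.2
    obtain ⟨t, ht⟩ := exists_bound_of_finite g (K := {z | z ∈ p.support}) (List.finite_toSet _)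
    obtain ⟨M, htM, hkM, hMx, hMy⟩ := hfreq t
    have hg' : ∀ r, k ≤ r → IsLineLike g r := fun r hr => ⟨γ r, hγ r hr, hγ' r hr⟩
    have e1 := (hγ M hkM.le).2 (k + 1) M (by rw [abs_of_nonneg] <;> omega) (by simp)
    have e2 := (hγ M hkM.le).2 (k + 1) (-M) (by rw [abs_of_nonneg] <;> omega) (by simp)
    have e3 := (hγ M hkM.le).2 (-(k + 1)) M (by rw [abs_neg, abs_of_nonneg] <;> omega) (by simp)
    have e4 := (hγ M hkM.le).2 (-(k + 1)) (-M) (by rw [abs_neg, abs_of_nonneg] <;> omega) (by simp)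
    rw [hMx] at e1 e2
    rw [hMy] at e3 e4
    simp only [abs_eq_max_neg] at e1 e2 e3 e4
    have := dist_endpoints_lt_of_walk hg' hk (hγ M hkM.le) p (fun z hz => ⟨?_, ?_⟩) (by omega)
    · change g.graph.dist y _ < g.graph.dist y _ at this
      omega
    · have := hp z hz
      rw [hK] at this
      omega
    · exact (ht z hz).trans htM
  rw [show (2 : ℕ∞) = 1 + 1 by norm_num, ENat.add_one_le_iff (by simp), Set.one_lt_encard_iff]
  exact ⟨_, _, hx_inf, hy_inf, hne⟩

lemma isEnded_two_of_nearAxis {g : RootedGraph.{u}} {k : ℕ} (hg : ∀ r, NearAxis g 50 k r) :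
    IsEnded g.graph 2 := by
  have h : ∀ r, k + 3 ≤ r → IsLineLike g r := fun r hr =>
    exists_forall_isLineLike hg r (by omega)
  refine ⟨⟨(finite_graphBall g (k + 3)).toFinset, le_antisymm ?_ ?_⟩, ?_⟩
  · exact encard_infinite_components_le_two h _
  · exact two_le_encard_infinite_components h (by omega)
  · rintro _ ⟨K, rfl⟩
    exact encard_infinite_components_le_two h K

lemma hasLinearGrowth_of_ballGrowth {g : RootedGraph.{u}} {l : ℕ} (hg : ∀ r, BallGrowth g l r) :
    HasLinearGrowth g.graph := by
  refine ⟨g.root, lt_of_le_of_lt (b := ((2 * l : ℕ) : ℝ≥0∞))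
    (limsup_le_of_le (by isBoundedDefault) ?_) (ENNReal.natCast_lt_top _)⟩
  filter_upwards [eventually_ge_atTop 1] with n hn
  refine ENNReal.div_le_of_le_mul ?_
  have h1 : ((graphBall g.graph g.root n).encard : ℝ≥0∞) ≤ ((l * (n + 1) : ℕ) : ℕ∞) := by
    exact_mod_cast hg n
  refine h1.trans ?_
  have : l * (n + 1) ≤ 2 * l * n := by nlinarith
  exact_mod_cast this

/-! ### The cells of a geodesic -/

/-- `γ` restricts to a geodesic on the integers of `[0, D]`. -/
def IsGeodesicSeq {V : Type u} (G : SimpleGraph V) (γ : ℕ → V) (D : ℕ) : Prop :=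
  ∀ a b : ℕ, a ≤ D → b ≤ D → (G.dist (γ a) (γ b) : ℤ) = |(a : ℤ) - b|

lemma exists_isGeodesicSeq {V : Type u} {G : SimpleGraph V} (hG : G.Connected) :
    ∃ γ, IsGeodesicSeq G γ G.diam := by
  have := hG.nonempty
  obtain ⟨x, y, hxy⟩ := G.exists_dist_eq_diam
  obtain ⟨p, hp⟩ := hG.exists_walk_length_eq_dist x y
  have key : ∀ a b : ℕ, a ≤ b → b ≤ G.diam → G.dist (p.getVert a) (p.getVert b) = b - a := by
    intro a b hab hb
    have h1 := SimpleGraph.dist_le (p.take a)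
    have h2 := SimpleGraph.dist_le (p.drop b)
    have h3 := SimpleGraph.dist_le (((p.drop a).take (b - a)).copy rfl
      (by rw [SimpleGraph.Walk.drop_getVert, Nat.add_sub_cancel' hab]))
    have h4 := hG.dist_triangle (u := x) (v := p.getVert a) (w := y)
    have h5 := hG.dist_triangle (u := p.getVert a) (v := p.getVert b) (w := y)
    rw [SimpleGraph.Walk.take_length] at h1
    rw [SimpleGraph.Walk.drop_length] at h2
    rw [SimpleGraph.Walk.length_copy, SimpleGraph.Walk.take_length] at h3
    have := min_le_left a p.length
    have := min_le_left (b - a) (p.drop a).length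
    omega
  refine ⟨p.getVert, fun a b ha hb => ?_⟩
  rcases le_total a b with hab | hab
  · rw [key a b hab hb, abs_sub_comm, abs_of_nonneg (by omega)]
    omega
  · rw [SimpleGraph.dist_comm, key b a hab ha, abs_of_nonneg (by omega)]
    omega

lemma IsGeodesicSeq.injOn {V : Type u} {G : SimpleGraph V} {γ : ℕ → V} {D : ℕ}
    (hγ : IsGeodesicSeq G γ D) : Set.InjOn γ {i | i ≤ D} := by
  intro a ha b hb hab
  have := hγ a b ha hb
  rw [hab, SimpleGraph.dist_self, Nat.cast_zero] at this
  have := abs_eq_zero.1 this.symm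
  omega

lemma exists_isNearest {V : Type u} (G : SimpleGraph V) (γ : ℕ → V) (D : ℕ) (v : V) :
    ∃ j, j ≤ D ∧ ∀ i ≤ D, G.dist v (γ j) ≤ G.dist v (γ i) := by
  obtain ⟨j, hj, h⟩ := Finset.exists_min_image (Finset.range (D + 1)) (fun i => G.dist v (γ i))
    ⟨0, by simp⟩
  exact ⟨j, Finset.mem_range_succ_iff.1 hj, fun i hi => h i (Finset.mem_range_succ_iff.2 hi)⟩

/-- The least index `j ≤ D` for which `γ j` is nearest to `v` among `γ 0, …, γ D`. -/
noncomputable def nearestIndex {V : Type u} (G : SimpleGraph V) (γ : ℕ → V) (D : ℕ) (v : V) : ℕ :=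
  open Classical in Nat.find (exists_isNearest G γ D v)

section

variable {V : Type u} {G : SimpleGraph V} {γ : ℕ → V} {D : ℕ}

lemma nearestIndex_le (v : V) : nearestIndex G γ D v ≤ D := by
  classical exact (Nat.find_spec (exists_isNearest G γ D v)).1

lemma dist_nearestIndex_le (v : V) {i : ℕ} (hi : i ≤ D) :
    G.dist v (γ (nearestIndex G γ D v)) ≤ G.dist v (γ i) := by
  classical exact (Nat.find_spec (exists_isNearest G γ D v)).2 i hi

lemma nearestIndex_le_of_dist_le (v : V) {j : ℕ} (hj : j ≤ D)
    (h : G.dist v (γ j) ≤ G.dist v (γ (nearestIndex G γ D v))) : nearestIndex G γ D v ≤ j := by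
  classical
  exact Nat.find_min' (exists_isNearest G γ D v)
    ⟨hj, fun i hi => h.trans (dist_nearestIndex_le v hi)⟩

/-- The vertices of a geodesic from `v` to its nearest vertex on `γ` have the same nearest vertex
on `γ` as `v`; the choice of the least index makes ties harmless. -/
lemma nearestIndex_eq_of_between (hG : G.Connected) {u v : V}
    (h : G.dist v u + G.dist u (γ (nearestIndex G γ D v))
      ≤ G.dist v (γ (nearestIndex G γ D v))) :
    nearestIndex G γ D u = nearestIndex G γ D v := by
  have h1 := hG.dist_triangle (u := v) (v := u) (w := γ (nearestIndex G γ D u))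
  have h2 := dist_nearestIndex_le (G := G) (γ := γ) u (nearestIndex_le (G := G) (γ := γ) (D := D) v)
  have h3 := dist_nearestIndex_le (G := G) (γ := γ) v (nearestIndex_le (G := G) (γ := γ) (D := D) u)
  apply le_antisymm
  · exact nearestIndex_le_of_dist_le u (nearestIndex_le v) (by omega)
  · exact nearestIndex_le_of_dist_le v (nearestIndex_le u) (by omega)

lemma abs_nearestIndex_sub_le (hG : G.Connected) (hγ : IsGeodesicSeq G γ D) {i : ℕ} (hi : i ≤ D)
    (v : V) : |(nearestIndex G γ D v : ℤ) - i| ≤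
      G.dist v (γ (nearestIndex G γ D v)) + G.dist v (γ i) := by
  have h := hγ (nearestIndex G γ D v) i (nearestIndex_le v) hi
  have h1 := hG.dist_triangle (u := γ (nearestIndex G γ D v)) (v := v) (w := γ i)
  rw [G.dist_comm (v := v)] at h1
  omega

end

section

variable {V : Type u} [Fintype V] {G : SimpleGraph V} {γ : ℕ → V} {D : ℕ}

/-- The number of vertices whose nearest vertex on `γ` is `γ j` (with ties broken by
`nearestIndex`). -/
noncomputable def cellCard (G : SimpleGraph V) (γ : ℕ → V) (D j : ℕ) : ℕ :=
  open Classical in (Finset.univ.filter fun v => nearestIndex G γ D v = j).card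

lemma sum_cellCard : ∑ j ∈ Finset.range (D + 1), cellCard G γ D j = Fintype.card V := by
  classical
  exact (Finset.card_eq_sum_card_fiberwise fun v _ => by
    simpa [Nat.lt_succ_iff] using nearestIndex_le v).symm

lemma cellCard_eq_zero {j : ℕ} (hj : D < j) : cellCard G γ D j = 0 := by
  classical
  refine Finset.card_eq_zero.2 (Finset.filter_eq_empty_iff.2 fun v _ h => ?_)
  have := nearestIndex_le (G := G) (γ := γ) (D := D) v
  omega

lemma dist_lt_cellCard (hG : G.Connected) (v : V) :
    G.dist v (γ (nearestIndex G γ D v)) < cellCard G γ D (nearestIndex G γ D v) := by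
  classical
  obtain ⟨p, hp⟩ := hG.exists_walk_length_eq_dist v (γ (nearestIndex G γ D v))
  have hinj : Set.InjOn p.getVert {i | i ≤ p.length} :=
    (p.isPath_of_length_eq_dist hp).getVert_injOn
  rw [← hp, ← Nat.succ_le_iff, ← Nat.add_one, ← Finset.card_range (p.length + 1)]
  refine Finset.card_le_card_of_injOn p.getVert (fun t ht => ?_) fun a ha b hb hab =>
    hinj (by simpa [Nat.lt_succ_iff] using ha) (by simpa [Nat.lt_succ_iff] using hb) hab
  have ht' : t ≤ p.length := by simpa [Nat.lt_succ_iff] using ht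
  simp only [Finset.coe_filter, Finset.mem_univ, true_and, Set.mem_ofPred_eq]
  refine nearestIndex_eq_of_between hG ?_
  have h1 := SimpleGraph.dist_le (p.take t)
  have h2 := SimpleGraph.dist_le (p.drop t)
  rw [SimpleGraph.Walk.take_length] at h1
  rw [SimpleGraph.Walk.drop_length] at h2
  have := min_le_left t p.length
  omega

/-- A vertex `v` at distance at most `r` from `γ i` is at distance at most `r` from `γ` as well, so
that its cell has index within `2 * r` of `i`. -/
lemma encard_graphBall_le (hG : G.Connected) (hγ : IsGeodesicSeq G γ D) {i : ℕ} (hi : i ≤ D)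
    (r : ℕ) : (graphBall G (γ i) r).encard ≤
      (∑ j ∈ Finset.Icc (i - 2 * r) (i + 2 * r), cellCard G γ D j : ℕ) := by
  classical
  set s := Finset.univ.filter fun v => nearestIndex G γ D v ∈ Finset.Icc (i - 2 * r) (i + 2 * r)
    with hs
  have h1 : graphBall G (γ i) r ⊆ s := by
    intro v hv
    rw [mem_graphBall_iff hG, SimpleGraph.dist_comm] at hv
    have h2 := abs_nearestIndex_sub_le hG hγ hi v
    have h3 := dist_nearestIndex_le (G := G) (γ := γ) v hi
    rw [abs_eq_max_neg] at h2
    simp only [hs, Finset.coe_filter, Finset.mem_univ, true_and, Set.mem_ofPred_eq, Finset.mem_Icc]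
    omega
  refine (Set.encard_le_encard h1).trans ?_
  rw [Set.encard_coe_eq_coe_finsetCard]
  have h2 : s.card = ∑ j ∈ Finset.Icc (i - 2 * r) (i + 2 * r),
      (s.filter fun v => nearestIndex G γ D v = j).card :=
    Finset.card_eq_sum_card_fiberwise fun v hv => (Finset.mem_filter.1 hv).2
  rw [h2]
  exact_mod_cast Finset.sum_le_sum fun j _ =>
    Finset.card_le_card (Finset.filter_subset_filter _ (Finset.subset_univ _))

/-- If the cells near `γ i` are small compared with their distance from `γ i`, then the balls around
`γ i` stay close to `γ`, since a vertex far from `γ` lies in a large cell. -/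
lemma nearAxis_of_cellCard_le (hG : G.Connected) (hγ : IsGeodesicSeq G γ D) {i m k r : ℕ}
    (hri : r ≤ i) (hir : i + r ≤ D)
    (h : ∀ j ≤ D, |(i : ℤ) - j| ≤ 2 * r → (m * cellCard G γ D j : ℤ) ≤ k + |(i : ℤ) - j|) :
    NearAxis (rootAt G hG (γ i)) m (2 * k) r := by
  have near : ∀ v, G.dist v (γ i) ≤ r →
      ∃ a : ℤ, |a| ≤ r ∧ m * G.dist v (γ (i + a).toNat) ≤ 4 * r + 2 * k := by
    intro v hv
    set j := nearestIndex G γ D v with hj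
    have hjD : j ≤ D := nearestIndex_le v
    have h1 : |(j : ℤ) - i| ≤ G.dist v (γ j) + G.dist v (γ i) :=
      abs_nearestIndex_sub_le hG hγ (by omega) v
    have h2 : G.dist v (γ j) ≤ G.dist v (γ i) := dist_nearestIndex_le v (by omega)
    have h3 : G.dist v (γ j) < cellCard G γ D j := dist_lt_cellCard hG v
    rw [abs_sub_comm] at h1
    have h4 := h j hjD (by omega)
    have h5 : m * G.dist v (γ j) ≤ k + 2 * r := by
      have : m * G.dist v (γ j) ≤ m * cellCard G γ D j := Nat.mul_le_mul_left _ h3.le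
      have : ((m * cellCard G γ D j : ℕ) : ℤ) ≤ k + |(i : ℤ) - j| := by exact_mod_cast h4
      omega
    -- the nearest index is moved into the window of radius `r` around `i`
    obtain ⟨a, ha, hja⟩ : ∃ a : ℤ, |a| ≤ r ∧ |(j : ℤ) - (i + a)| ≤ G.dist v (γ j) := by
      refine ⟨max (-r) (min r (j - i)), ?_, ?_⟩ <;>
      · rw [abs_eq_max_neg] at h1 ⊢
        omega
    refine ⟨a, ha, ?_⟩
    rw [abs_le] at ha
    have h6 := hγ j (i + a).toNat hjD (by omega)
    rw [Int.toNat_of_nonneg (by omega)] at h6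
    have h7 := hG.dist_triangle (u := v) (v := γ j) (w := γ (i + a).toNat)
    have h8 : G.dist v (γ (i + a).toNat) ≤ 2 * G.dist v (γ j) := by omega
    calc m * G.dist v (γ (i + a).toNat) ≤ m * (2 * G.dist v (γ j)) := Nat.mul_le_mul_left _ h8
      _ = 2 * (m * G.dist v (γ j)) := by ring
      _ ≤ 4 * r + 2 * k := by omega
  refine ⟨fun a => γ (i + a).toNat, ⟨by simp [rootAt], fun a b ha hb => ?_⟩, fun v hv => ?_⟩
  · change (G.dist (γ _) (γ _) : ℤ) = _
    rw [abs_le] at ha hb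
    rw [hγ _ _ (by omega) (by omega), Int.toNat_of_nonneg (by omega),
      Int.toNat_of_nonneg (by omega)]
    congr 1
    ring
  · exact near v ((SimpleGraph.dist_comm (G := G)).trans_le hv)

end

/-! ### Counting the exceptional indices -/

open scoped Classical in
/-- The maximal inequality for averages over intervals that end at `i`. -/
lemma mul_card_left_average_le (w : ℕ → ℕ) (l n : ℕ) :
    l * {i ∈ Finset.range n | ∃ k, l * k < ∑ j ∈ Finset.Ico (i + 1 - k) (i + 1), w j}.card
      ≤ ∑ j ∈ Finset.range n, w j := by
  induction n using Nat.strong_induction_on with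
  | _ n ih =>
    rcases n with _ | n
    · simp
    by_cases h : ∃ k, l * k < ∑ j ∈ Finset.Ico (n + 1 - k) (n + 1), w j
    · obtain ⟨k, hk⟩ := h
      have hk0 : 0 < k := Nat.pos_of_ne_zero fun h0 => by simp [h0] at hk
      have h1 := ih (n + 1 - k) (by omega)
      have h2 : {i ∈ Finset.range (n + 1) |
            ∃ k, l * k < ∑ j ∈ Finset.Ico (i + 1 - k) (i + 1), w j} ⊆
          {i ∈ Finset.range (n + 1 - k) |
            ∃ k, l * k < ∑ j ∈ Finset.Ico (i + 1 - k) (i + 1), w j} ∪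
          Finset.Ico (n + 1 - k) (n + 1) := by
        intro i hi
        simp only [Finset.mem_union, Finset.mem_filter, Finset.mem_range, Finset.mem_Ico] at hi ⊢
        by_cases hik : i < n + 1 - k
        · exact Or.inl ⟨hik, hi.2⟩
        · exact Or.inr ⟨by omega, hi.1⟩
      have h3 := (Finset.card_le_card h2).trans (Finset.card_union_le _ _)
      rw [Nat.card_Ico] at h3
      have h4 : ∑ j ∈ Finset.range (n + 1 - k), w j + ∑ j ∈ Finset.Ico (n + 1 - k) (n + 1), w j =
          ∑ j ∈ Finset.range (n + 1), w j :=
        Finset.sum_range_add_sum_Ico _ (by omega)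
      rw [← h4]
      refine (Nat.mul_le_mul_left l h3).trans ?_
      rw [mul_add]
      refine Nat.add_le_add h1 ((Nat.mul_le_mul_left l ?_).trans hk.le)
      omega
    · rw [Finset.range_add_one, Finset.filter_insert, if_neg h,
        Finset.sum_insert Finset.notMem_range_self]
      exact (ih n (by omega)).trans (Nat.le_add_left _ _)

open scoped Classical in
/-- The maximal inequality for averages over intervals that start at `i`. -/
lemma mul_card_right_average_le (w : ℕ → ℕ) (l n : ℕ) (hw : ∀ j, n ≤ j → w j = 0) :
    l * {i ∈ Finset.range n | ∃ k, l * k < ∑ j ∈ Finset.Ico i (i + k), w j}.card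
      ≤ ∑ j ∈ Finset.range n, w j := by
  have key : ∀ d i, n - i ≤ d →
      l * {i ∈ Finset.Ico i n | ∃ k, l * k < ∑ j ∈ Finset.Ico i (i + k), w j}.card
        ≤ ∑ j ∈ Finset.Ico i n, w j := by
    intro d
    induction d with
    | zero =>
      intro i hi
      rw [Finset.Ico_eq_empty (by omega)]
      simp
    | succ d ih =>
      intro i hi
      by_cases hin : n ≤ i
      · rw [Finset.Ico_eq_empty (by omega)]
        simp
      by_cases h : ∃ k, l * k < ∑ j ∈ Finset.Ico i (i + k), w j
      · obtain ⟨k, hk⟩ := h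
        have hk0 : 0 < k := Nat.pos_of_ne_zero fun h0 => by simp [h0] at hk
        set e := min (i + k) n with he
        have h0 : ∑ j ∈ Finset.Ico i (i + k), w j = ∑ j ∈ Finset.Ico i e, w j := by
          symm
          refine Finset.sum_subset (Finset.Ico_subset_Ico_right (by omega)) fun j hj hj' => hw j ?_
          rw [Finset.mem_Ico] at hj hj'
          omega
        have h1 := ih e (by omega)
        have h2 : {i ∈ Finset.Ico i n | ∃ k, l * k < ∑ j ∈ Finset.Ico i (i + k), w j} ⊆
            Finset.Ico i e ∪
              {i ∈ Finset.Ico e n | ∃ k, l * k < ∑ j ∈ Finset.Ico i (i + k), w j} := by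
          intro a ha
          simp only [Finset.mem_union, Finset.mem_filter, Finset.mem_Ico] at ha ⊢
          by_cases hae : a < e
          · exact Or.inl ⟨ha.1.1, hae⟩
          · exact Or.inr ⟨⟨by omega, ha.1.2⟩, ha.2⟩
        have h3 := (Finset.card_le_card h2).trans (Finset.card_union_le _ _)
        rw [Nat.card_Ico] at h3
        rw [← Finset.sum_Ico_consecutive w (show i ≤ e by omega) (show e ≤ n by omega), ← h0]
        refine (Nat.mul_le_mul_left l h3).trans ?_
        rw [mul_add]
        refine Nat.add_le_add ((Nat.mul_le_mul_left l ?_).trans hk.le) h1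
        omega
      · rw [← Finset.insert_Ico_add_one_left_eq_Ico (by omega), Finset.filter_insert, if_neg h,
          Finset.sum_insert (by simp)]
        exact (ih (i + 1) (by omega)).trans (Nat.le_add_left _ _)
  simpa only [Finset.range_eq_Ico] using key n 0 (by omega)

open scoped Classical in
/-- Few indices are the centre of an interval on which the average of `w` is large. -/
lemma mul_card_large_average_le (w : ℕ → ℕ) (l n : ℕ) (hw : ∀ j, n ≤ j → w j = 0) :
    l * {i ∈ Finset.range n |
      ∃ r, 4 * l * (r + 1) < ∑ j ∈ Finset.Icc (i - 2 * r) (i + 2 * r), w j}.card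
      ≤ 2 * ∑ j ∈ Finset.range n, w j := by
  have h1 := mul_card_left_average_le w l n
  have h2 := mul_card_right_average_le w l n hw
  have h3 : {i ∈ Finset.range n |
      ∃ r, 4 * l * (r + 1) < ∑ j ∈ Finset.Icc (i - 2 * r) (i + 2 * r), w j} ⊆
      {i ∈ Finset.range n | ∃ k, l * k < ∑ j ∈ Finset.Ico (i + 1 - k) (i + 1), w j} ∪
        {i ∈ Finset.range n | ∃ k, l * k < ∑ j ∈ Finset.Ico i (i + k), w j} := by
    intro i hi
    simp only [Finset.mem_union, Finset.mem_filter] at hi ⊢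
    obtain ⟨hi, r, hr⟩ := hi
    by_contra! h
    have h4 := h.1 hi (2 * r + 1)
    have h5 := h.2 hi (2 * r + 1)
    have h6 : Finset.Icc (i - 2 * r) (i + 2 * r) ⊆
        Finset.Ico (i + 1 - (2 * r + 1)) (i + 1) ∪ Finset.Ico i (i + (2 * r + 1)) := by
      intro j hj
      simp only [Finset.mem_union, Finset.mem_Ico, Finset.mem_Icc] at hj ⊢
      omega
    have h7 := Finset.sum_le_sum_of_subset (f := w) h6
    have h8 := Finset.sum_union_inter (f := w)
      (s₁ := Finset.Ico (i + 1 - (2 * r + 1)) (i + 1)) (s₂ := Finset.Ico i (i + (2 * r + 1)))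
    have h9 : 2 * (l * (2 * r + 1)) ≤ 4 * l * (r + 1) := by nlinarith
    omega
  have h4 := (Finset.card_le_card h3).trans (Finset.card_union_le _ _)
  calc _ ≤ _ := Nat.mul_le_mul_left l h4
    _ ≤ _ := by rw [mul_add]; omega

open scoped Classical in
/-- The indices within distance `2 R` of which some value of `w` is large compared with its
distance are few, as soon as raising the truncation level from `k` to `M` does not add much to the
sum of `w`. -/
lemma card_large_value_le (w : ℕ → ℕ) (n m k M R : ℕ) (hm : 0 < m) (hM : 2 * R + 1 ≤ M)
    (hkM : 2 * k ≤ M) :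
    (Finset.filter (fun i : ℕ => ∃ j < n, |(i : ℤ) - j| ≤ 2 * R ∧
        ((2 * k * m : ℕ) : ℤ) + |(i : ℤ) - j| < m * w j) (Finset.range n)).card +
      6 * m * ∑ j ∈ Finset.range n, min (w j) k ≤
      6 * m * ∑ j ∈ Finset.range n, min (w j) M := by
  -- a large value at `j` affects only indices within `B j` of `j`
  set B : ℕ → ℕ := fun j => m * min (w j) M with hB
  have h1 : Finset.filter (fun i : ℕ => ∃ j < n, |(i : ℤ) - j| ≤ 2 * R ∧
      ((2 * k * m : ℕ) : ℤ) + |(i : ℤ) - j| < m * w j) (Finset.range n) ⊆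
      ({j ∈ Finset.range n | 2 * k < w j}).biUnion fun j => Finset.Icc (j - B j) (j + B j) := by
    intro i hi
    simp only [Finset.mem_filter, Finset.mem_biUnion, Finset.mem_Icc, Finset.mem_range] at hi ⊢
    obtain ⟨hi, j, hj, hij, hw⟩ := hi
    have hw' : 2 * k * m < m * w j := by
      have := abs_nonneg ((i : ℤ) - j)
      have : ((2 * k * m : ℕ) : ℤ) < ((m * w j : ℕ) : ℤ) := by push_cast at hw ⊢; linarith
      exact_mod_cast this
    refine ⟨j, ⟨hj, by rw [mul_comm] at hw'; exact lt_of_mul_lt_mul_left hw' (Nat.zero_le m)⟩, ?_⟩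
    have h2 : |(i : ℤ) - j| ≤ B j := by
      rcases le_total (w j) M with h | h
      · simp only [hB, min_eq_left h]
        push_cast at hw ⊢
        have : (0 : ℤ) ≤ 2 * k * m := by positivity
        linarith
      · simp only [hB, min_eq_right h]
        have : M ≤ m * M := Nat.le_mul_of_pos_left _ hm
        omega
    rw [abs_le] at h2
    omega
  have h2 : ∀ j ∈ {j ∈ Finset.range n | 2 * k < w j},
      (Finset.Icc (j - B j) (j + B j)).card ≤ 3 * B j := by
    intro j hj
    have hj' := (Finset.mem_filter.1 hj).2
    have : 0 < B j := Nat.mul_pos hm (by omega)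
    rw [Nat.card_Icc]
    omega
  have h3 := (Finset.card_le_card h1).trans (Finset.card_biUnion_le.trans (Finset.sum_le_sum h2))
  have h4 : ∑ j ∈ {j ∈ Finset.range n | 2 * k < w j}, 3 * B j +
      6 * m * ∑ j ∈ Finset.range n, min (w j) k ≤ 6 * m * ∑ j ∈ Finset.range n, min (w j) M := by
    rw [Finset.sum_filter, Finset.mul_sum, Finset.mul_sum, ← Finset.sum_add_distrib]
    refine Finset.sum_le_sum fun j _ => ?_
    split_ifs with h
    · -- the truncation at `k` loses at least half of `min (w j) M`, as `2 * k < w j`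
      have : min (w j) M + 2 * min (w j) k ≤ 2 * min (w j) M := by omega
      simp only [hB]
      nlinarith
    · rw [zero_add]
      exact Nat.mul_le_mul_left _ (by omega)
  omega

/-! ### Vertices of a geodesic around which the graph is close to a line -/

/-- The rooted graphs that are close to a line up to scale `R`: the balls of radius `r ≤ R` have
size linear in `r`, with constant `l`, and for `m ≤ R` they stay within distance
`(4 * r + K m) / (m + 1)` of a centred geodesic. -/
def lineEvent (l : ℕ) (K : ℕ → ℕ) (R : ℕ) : Set RootedGraph.{u} :=
  {g | ∀ r ≤ R, BallGrowth g l r ∧ ∀ m ≤ R, NearAxis g (m + 1) (K m) r}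

lemma lineEvent_antitone (l : ℕ) (K : ℕ → ℕ) : Antitone (lineEvent.{u} l K) :=
  fun _ _ hRS _ hg r hr => ⟨(hg r (hr.trans hRS)).1, fun m hm =>
    (hg r (hr.trans hRS)).2 m (hm.trans hRS)⟩

lemma isClopen_lineEvent (l : ℕ) (K : ℕ → ℕ) (R : ℕ) : IsClopen (lineEvent.{u} l K R) := by
  refine DependsOnBall.isClopen (s := 3 * R) fun g h H hg r hr => ⟨?_, fun m hm => ?_⟩
  · exact dependsOnBall_ballGrowth l r g h (H.mono (by omega)) (hg r hr).1
  · exact dependsOnBall_nearAxis (m + 1) (K m) r g h (H.mono (by omega)) ((hg r hr).2 m hm)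

lemma le_uniformRootLaw {V : Type u} [Fintype V] {G : SimpleGraph V} (hG : G.Connected)
    {A : Set RootedGraph.{u}} (hA : MeasurableSet A) (s : Finset V)
    (hs : ∀ x ∈ s, rootAt G hG x ∈ A) :
    (s.card : ℝ) / Fintype.card V ≤ (uniformRootLaw G hG A : ℝ) := by
  classical
  have : Nonempty V := hG.nonempty
  have h1 : ((uniformRootLaw G hG : Measure RootedGraph.{u}) A) =
      (Fintype.card (rootAt G hG ⁻¹' A) : ℝ≥0∞) / Fintype.card V := by
    change ((PMF.uniformOfFintype V).map (rootAt G hG)).toMeasure A = _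
    rw [PMF.toMeasure_apply_eq_toOuterMeasure_apply _ hA, PMF.toOuterMeasure_map_apply,
      PMF.toOuterMeasure_uniformOfFintype_apply]
  have h2 : s.card ≤ Fintype.card (rootAt G hG ⁻¹' A) := by
    rw [← Set.toFinset_card]
    exact Finset.card_le_card fun x hx => by simpa using hs x hx
  have h3 : (uniformRootLaw G hG A : ℝ) =
      (Fintype.card (rootAt G hG ⁻¹' A) : ℝ) / Fintype.card V := by
    change ((uniformRootLaw G hG : Measure RootedGraph.{u}) A).toReal = _
    rw [h1, ENNReal.toReal_div, ENNReal.toReal_natCast, ENNReal.toReal_natCast]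
  rw [h3]
  gcongr

section

variable {V : Type u} [Fintype V] {G : SimpleGraph V} {γ : ℕ → V} {D : ℕ}

open scoped Classical in
/-- A vertex of the geodesic around which the graph is not close to a line is close to an end of the
geodesic, or to cells that are large on average, or to a cell that is large compared with its
distance. -/
lemma card_notMem_lineEvent_le (hG : G.Connected) (hγ : IsGeodesicSeq G γ D) (l : ℕ) (k : ℕ → ℕ)
    (R : ℕ) :
    {i ∈ Finset.range (D + 1) | rootAt G hG (γ i) ∉
        lineEvent (4 * l) (fun m => 2 * (2 * k m * (m + 1))) R}.card ≤
      {i ∈ Finset.range (D + 1) | ∃ r, 4 * l * (r + 1) <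
        ∑ j ∈ Finset.Icc (i - 2 * r) (i + 2 * r), cellCard G γ D j}.card +
      (∑ m ∈ Finset.range (R + 1), (Finset.filter (fun i : ℕ => ∃ j < D + 1, |(i : ℤ) - j| ≤ 2 * R ∧
        ((2 * k m * (m + 1) : ℕ) : ℤ) + |(i : ℤ) - j| < (m + 1 : ℕ) * cellCard G γ D j)
        (Finset.range (D + 1))).card + 2 * R) := by
  set B₀ := {i ∈ Finset.range (D + 1) | ∃ r, 4 * l * (r + 1) <
        ∑ j ∈ Finset.Icc (i - 2 * r) (i + 2 * r), cellCard G γ D j} with hB₀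
  set B : ℕ → Finset ℕ := fun m => Finset.filter (fun i : ℕ => ∃ j < D + 1, |(i : ℤ) - j| ≤ 2 * R ∧
        ((2 * k m * (m + 1) : ℕ) : ℤ) + |(i : ℤ) - j| < (m + 1 : ℕ) * cellCard G γ D j)
        (Finset.range (D + 1)) with hB
  have hsub : {i ∈ Finset.range (D + 1) | rootAt G hG (γ i) ∉
      lineEvent (4 * l) (fun m => 2 * (2 * k m * (m + 1))) R} ⊆
      B₀ ∪ ((Finset.range (R + 1)).biUnion B ∪
        (Finset.range R ∪ Finset.Ico (D + 1 - R) (D + 1))) := by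
    intro i hi
    rw [Finset.mem_filter] at hi
    obtain ⟨hiD, hi⟩ := hi
    rw [Finset.mem_range] at hiD
    by_contra hbad
    simp only [Finset.mem_union, not_or, Finset.mem_biUnion, not_exists, not_and, Finset.mem_range,
      Finset.mem_Ico] at hbad
    obtain ⟨h0, hm, h1, h2⟩ := hbad
    refine hi fun r hr => ⟨?_, fun m hmR => ?_⟩
    · refine (encard_graphBall_le hG hγ (Nat.lt_succ_iff.1 hiD) r).trans ?_
      simp only [hB₀, Finset.mem_filter, Finset.mem_range, not_and, not_exists, not_lt] at h0
      exact_mod_cast h0 hiD r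
    · refine nearAxis_of_cellCard_le hG hγ (by omega) (by omega) fun j hj hij => ?_
      have h3 := hm m (by omega)
      simp only [hB, Finset.mem_filter, Finset.mem_range, not_and, not_exists, not_lt] at h3
      exact h3 hiD j (by omega) (hij.trans (by omega))
  refine (Finset.card_le_card hsub).trans ((Finset.card_union_le _ _).trans ?_)
  gcongr
  refine (Finset.card_union_le _ _).trans ?_
  gcongr
  · exact Finset.card_biUnion_le
  · refine (Finset.card_union_le _ _).trans ?_
    rw [Finset.card_range, Nat.card_Ico]
    omega

/-- If the average cell size is at most `C` and its truncated tails are small, then the good vertices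
of the geodesic make up almost a proportion `1 / C` of the graph. The three kinds of exceptional
vertices take up a proportion of at most `δ / 4` of the geodesic each. -/
lemma le_uniformRootLaw_lineEvent (hG : G.Connected) (hγ : IsGeodesicSeq G γ D) {C δ : ℝ}
    (hC : (Fintype.card V : ℝ) ≤ C * (D + 1)) (hC0 : 0 < C) (hδ : 0 < δ) (hδ1 : δ ≤ 1)
    {l : ℕ} (hl : 8 * C ≤ δ * l) {k : ℕ → ℕ} {R : ℕ}
    (hk : ∀ m ≤ R, ((∑ j ∈ Finset.range (D + 1),
        min (cellCard G γ D j) (max (2 * R + 1) (2 * k m)) : ℕ) : ℝ)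
        - (∑ j ∈ Finset.range (D + 1), min (cellCard G γ D j) (k m) : ℕ)
        ≤ δ / (24 * (m + 1)) * (1 / 2) ^ (m + 1) * (D + 1))
    (hR : 8 * R ≤ δ * (D + 1)) :
    (1 - δ) / C ≤ (uniformRootLaw G hG
      (lineEvent (4 * l) (fun m => 2 * (2 * k m * (m + 1))) R) : ℝ) := by
  classical
  have hbad := card_notMem_lineEvent_le hG hγ l k R
  set E : Set RootedGraph.{u} := lineEvent (4 * l) (fun m => 2 * (2 * k m * (m + 1))) R
  set n : ℝ := (D : ℝ) + 1 with hn
  have hn0 : 0 < n := by positivity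
  have hl0 : (0 : ℝ) < l := by
    by_contra h
    have : δ * l ≤ 0 := mul_nonpos_of_nonneg_of_nonpos hδ.le (not_lt.1 h)
    linarith
  set b₀ := {i ∈ Finset.range (D + 1) | ∃ r, 4 * l * (r + 1) <
        ∑ j ∈ Finset.Icc (i - 2 * r) (i + 2 * r), cellCard G γ D j}.card with hb₀
  set b : ℕ → ℕ := fun m =>
    (Finset.filter (fun i : ℕ => ∃ j < D + 1, |(i : ℤ) - j| ≤ 2 * R ∧
        ((2 * k m * (m + 1) : ℕ) : ℤ) + |(i : ℤ) - j| < (m + 1 : ℕ) * cellCard G γ D j)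
        (Finset.range (D + 1))).card with hb
  have h0 : (b₀ : ℝ) ≤ δ / 4 * n := by
    have h := mul_card_large_average_le (cellCard G γ D) l (D + 1) fun j hj => cellCard_eq_zero hj
    rw [sum_cellCard] at h
    have h' : (l : ℝ) * b₀ ≤ 2 * Fintype.card V := by exact_mod_cast h
    have h2 : (l : ℝ) * b₀ ≤ l * (δ / 4 * n) := by
      have := mul_le_mul_of_nonneg_right hl hn0.le
      nlinarith
    exact le_of_mul_le_mul_left h2 hl0
  have h1 : ∀ m ∈ Finset.range (R + 1), (b m : ℝ) ≤ δ / 4 * n * (1 / 2) ^ (m + 1) := by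
    intro m hm
    have h : b m + 6 * (m + 1) *
        ∑ j ∈ Finset.range (D + 1), min (cellCard G γ D j) (k m) ≤ 6 * (m + 1) *
        ∑ j ∈ Finset.range (D + 1),
          min (cellCard G γ D j) (max (2 * R + 1) (2 * k m)) :=
      card_large_value_le (cellCard G γ D) (D + 1) (m + 1) (k m)
      (max (2 * R + 1) (2 * k m)) R (Nat.succ_pos m) (le_max_left _ _) (le_max_right _ _)
    have h' : (b m : ℝ) + 6 * (m + 1) *
        (∑ j ∈ Finset.range (D + 1), min (cellCard G γ D j) (k m) : ℕ) ≤ 6 * (m + 1) *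
        (∑ j ∈ Finset.range (D + 1),
          min (cellCard G γ D j) (max (2 * R + 1) (2 * k m)) : ℕ) := by
      exact_mod_cast h
    have h2 := mul_le_mul_of_nonneg_left (hk m (Finset.mem_range_succ_iff.1 hm))
      (show (0 : ℝ) ≤ 6 * (m + 1) by positivity)
    have h3 : (6 * ((m : ℝ) + 1)) * (δ / (24 * (m + 1)) * (1 / 2) ^ (m + 1) * n) =
        δ / 4 * n * (1 / 2) ^ (m + 1) := by
      field_simp
      ring
    rw [h3, mul_sub] at h2
    linarith
  have h2 : ((∑ m ∈ Finset.range (R + 1), b m : ℕ) : ℝ) ≤ δ / 4 * n := by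
    rw [Nat.cast_sum]
    refine (Finset.sum_le_sum h1).trans ?_
    rw [← Finset.mul_sum]
    have h3 : ∑ m ∈ Finset.range (R + 1), (1 / 2 : ℝ) ^ (m + 1) ≤ 1 := by
      have h4 := sum_geometric_two_le (R + 1)
      simp only [pow_succ, ← Finset.sum_mul]
      linarith
    exact mul_le_of_le_one_right (by positivity) h3
  have hbad' : ({i ∈ Finset.range (D + 1) | rootAt G hG (γ i) ∉ E}.card : ℝ) ≤ δ * n := by
    have h3 : ({i ∈ Finset.range (D + 1) | rootAt G hG (γ i) ∉ E}.card : ℝ) ≤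
        b₀ + ((∑ m ∈ Finset.range (R + 1), b m : ℕ) + 2 * R) := by exact_mod_cast hbad
    have : 0 < δ * n := by positivity
    linarith
  have hsum := Finset.card_filter_add_card_filter_not (s := Finset.range (D + 1))
    (fun i => rootAt G hG (γ i) ∈ E)
  rw [Finset.card_range] at hsum
  have hgood : (1 - δ) * n ≤ ({i ∈ Finset.range (D + 1) | rootAt G hG (γ i) ∈ E}.card : ℝ) := by
    have : ({i ∈ Finset.range (D + 1) | rootAt G hG (γ i) ∈ E}.card : ℝ) +
        ({i ∈ Finset.range (D + 1) | rootAt G hG (γ i) ∉ E}.card : ℝ) = n := by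
      rw [hn]
      exact_mod_cast hsum
    linarith
  have h3 := le_uniformRootLaw hG (isClopen_lineEvent (4 * l) _ R).isOpen.measurableSet
    (({i ∈ Finset.range (D + 1) | rootAt G hG (γ i) ∈ E}).image γ) (by
      intro x hx
      obtain ⟨i, hi, rfl⟩ := Finset.mem_image.1 hx
      exact (Finset.mem_filter.1 hi).2)
  rw [Finset.card_image_of_injOn (hγ.injOn.mono fun i hi => by
    have := (Finset.mem_filter.1 hi).1
    rw [Finset.mem_range] at this
    exact Nat.lt_succ_iff.1 this)] at h3
  refine le_trans ?_ h3
  have hV : (0 : ℝ) < Fintype.card V := by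
    have := hG.nonempty
    exact_mod_cast Fintype.card_pos
  rw [div_le_div_iff₀ hC0 hV]
  calc (1 - δ) * (Fintype.card V : ℝ) ≤ (1 - δ) * (C * n) := by gcongr
    _ = (1 - δ) * n * C := by ring
    _ ≤ _ := by gcongr

end

/-! ### Passage to the limit -/

/-- Bounded families that are monotone in the level `k` can be truncated at a level beyond which,
in the limit along an ultrafilter, nothing is gained. -/
lemma exists_level (U : Ultrafilter ℕ) {a : ℕ → ℕ → ℝ} {C : ℝ} (h0 : ∀ n k, 0 ≤ a n k)
    (hC : ∀ n k, a n k ≤ C) {δ : ℝ} (hδ : 0 < δ) :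
    ∃ k, ∀ M, ∀ᶠ n in (U : Filter ℕ), a n M - a n k ≤ δ := by
  have hlim : ∀ k, ∃ x ∈ Set.Icc 0 C, Tendsto (fun n => a n k) U (𝓝 x) := fun k =>
    isCompact_Icc.ultrafilter_le_nhds' (U.map fun n => a n k)
      (Ultrafilter.mem_map.2 (Filter.univ_mem' fun n => ⟨h0 n k, hC n k⟩))
  choose φ hφ hlim using hlim
  have hbdd : BddAbove (Set.range φ) := ⟨C, by rintro _ ⟨k, rfl⟩; exact (hφ k).2⟩
  obtain ⟨k, hk⟩ := exists_lt_of_lt_ciSup (show iSup φ - δ < iSup φ by linarith)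
  refine ⟨k, fun M => ?_⟩
  have h1 : φ M - φ k < δ := by linarith [le_ciSup hbdd M]
  exact (((hlim M).sub (hlim k)).eventually_lt_const h1).mono fun n hn => hn.le

lemma lt_encard_graphBall (g : RootedGraph.{u}) [Infinite g.V] (b : ℕ) :
    (b : ℕ∞) < (graphBall g.graph g.root b).encard := by
  obtain ⟨x, -, hx⟩ := exists_lt_dist_of_infinite g (Set.infinite_univ (α := g.V)) b
  have key : ∀ s : ℕ, s ≤ b → ∃ y, g.graph.dist g.root y = s := fun s hs => by
    obtain ⟨y, hy, -⟩ := exists_dist_eq g.connected (hs.trans hx.le)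
    exact ⟨y, hy⟩
  have : Nonempty g.V := ⟨g.root⟩
  choose! y hy using key
  have h1 : (y '' Set.Iic b).encard = (Set.Iic b).encard :=
    Set.InjOn.encard_image fun s hs t ht hst => by rw [← hy s hs, ← hy t ht, hst]
  have h2 : y '' Set.Iic b ⊆ graphBall g.graph g.root b := by
    rintro _ ⟨s, hs, rfl⟩
    rw [mem_graphBall_iff g.connected, hy s hs]
    exact hs
  have h3 : (Set.Iic b).encard = ((b + 1 : ℕ) : ℕ∞) := by
    rw [← Finset.coe_Iic, Set.encard_coe_eq_coe_finsetCard, Nat.card_Iic]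
  refine lt_of_lt_of_le ?_ (Set.encard_le_encard h2)
  rw [h1, h3]
  exact_mod_cast Nat.lt_succ_self b

section

variable {V : ℕ → Type u} [∀ n, Fintype (V n)] {G : ∀ n, SimpleGraph (V n)}
  {hG : ∀ n, (G n).Connected} {S : Type v} [MeasurableSpace S] {P : Measure S}
  [IsProbabilityMeasure P] {X : S → RootedGraph.{u}} {hX : Measurable X}

lemma law_eq (A : Set RootedGraph.{u}) (hA : MeasurableSet A) :
    (law P X hX A : ℝ) = P.real (X ⁻¹' A) := by
  change ((P.map X) A).toReal = _
  rw [Measure.map_apply hX hA]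
  rfl

lemma BenjaminiSchrammConverges.tendsto_real (hconv : BenjaminiSchrammConverges G hG P X hX)
    {A : Set RootedGraph.{u}} (hA : IsClopen A) :
    Tendsto (fun n => (uniformRootLaw (G n) (hG n) A : ℝ)) atTop (𝓝 (P.real (X ⁻¹' A))) := by
  rw [← law_eq (hX := hX) A hA.isOpen.measurableSet]
  exact (NNReal.continuous_coe.tendsto _).comp
    (ProbabilityMeasure.tendsto_measure_of_isClopen_of_tendsto hconv hA)

/-- As the limit is infinite, the number of vertices tends to infinity. -/
lemma BenjaminiSchrammConverges.eventually_lt_card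
    (hconv : BenjaminiSchrammConverges G hG P X hX) (hinf : ∀ᵐ ω ∂P, Infinite (X ω).V) (b : ℕ) :
    ∀ᶠ n in atTop, b < Fintype.card (V n) := by
  set A : Set RootedGraph.{u} := {g | (graphBall g.graph g.root b).encard ≤ b}
  have hA : IsClopen A := (dependsOnBall_encard_le b b).isClopen
  have h0 : P.real (X ⁻¹' A) = 0 := by
    rw [measureReal_def, (measure_eq_zero_iff_ae_notMem).2, ENNReal.toReal_zero]
    filter_upwards [hinf] with ω hω
    exact not_le.2 (lt_encard_graphBall (X ω) b)
  have h1 := hconv.tendsto_real hA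
  rw [h0] at h1
  filter_upwards [h1.eventually_lt_const one_pos] with n hn
  by_contra! hcard
  have h2 := le_uniformRootLaw (hG n) hA.isOpen.measurableSet Finset.univ fun x _ => by
    refine le_trans (b := (Set.univ : Set (V n)).encard)
      (Set.encard_le_encard (Set.subset_univ _)) ?_
    change (Set.univ : Set (V n)).encard ≤ b
    rw [Set.encard_univ, ENat.card_eq_coe_fintype_card]
    exact_mod_cast hcard
  have hV : (0 : ℝ) < Fintype.card (V n) := by
    have := (hG n).nonempty
    exact_mod_cast Fintype.card_pos
  rw [Finset.card_univ, div_self hV.ne'] at h2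
  linarith

/-- The constants `l` and `K` depend on `δ`, but not on the scale `R`. -/
lemma exists_forall_le_lineEvent (hconv : BenjaminiSchrammConverges G hG P X hX)
    (hinf : ∀ᵐ ω ∂P, Infinite (X ω).V) {C : ℝ} (hC0 : 0 < C)
    (hC : ∀ n, (Fintype.card (V n) : ℝ) ≤ C * ((G n).diam + 1)) {δ : ℝ} (hδ : 0 < δ)
    (hδ1 : δ ≤ 1) :
    ∃ (l : ℕ) (K : ℕ → ℕ), ∀ R, (1 - δ) / C ≤ P.real (X ⁻¹' lineEvent l K R) := by
  choose γ hγ using fun n => exists_isGeodesicSeq (hG n)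
  let U : Ultrafilter ℕ := hyperfilter ℕ
  have hU : (U : Filter ℕ) ≤ atTop := Nat.hyperfilter_le_atTop
  let a : ℕ → ℕ → ℝ := fun n k => ((∑ j ∈ Finset.range ((G n).diam + 1),
    min (cellCard (G n) (γ n) (G n).diam j) k : ℕ) : ℝ) / ((G n).diam + 1)
  have ha0 : ∀ n k, 0 ≤ a n k := fun n k => by positivity
  have haC : ∀ n k, a n k ≤ C := by
    intro n k
    rw [div_le_iff₀ (by positivity)]
    refine le_trans ?_ (hC n)
    rw [← sum_cellCard (G := G n) (γ := γ n) (D := (G n).diam)]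
    exact_mod_cast Finset.sum_le_sum fun j _ => min_le_left _ _
  choose k hk using fun m : ℕ => exists_level U ha0 haC
    (show 0 < δ / (24 * ((m : ℝ) + 1)) * (1 / 2) ^ (m + 1) by positivity)
  obtain ⟨l, hl⟩ := exists_nat_ge (8 * C / δ)
  rw [div_le_iff₀' hδ] at hl
  refine ⟨4 * l, fun m => 2 * (2 * k m * (m + 1)), fun R => ?_⟩
  refine ge_of_tendsto ((hconv.tendsto_real (isClopen_lineEvent _ _ R)).mono_left hU) ?_
  have h1 : ∀ᶠ n in (U : Filter ℕ), ∀ m ∈ Finset.range (R + 1),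
      a n (max (2 * R + 1) (2 * k m)) - a n (k m) ≤
        δ / (24 * ((m : ℝ) + 1)) * (1 / 2) ^ (m + 1) :=
    (Filter.eventually_all_finset _).2 fun m _ => hk m _
  obtain ⟨b, hb⟩ := exists_nat_ge (8 * R / δ * C)
  filter_upwards [h1, hU (hconv.eventually_lt_card hinf b)] with n hn hbn
  have hbn' : (b : ℝ) < Fintype.card (V n) := by exact_mod_cast hbn
  refine le_uniformRootLaw_lineEvent (hG n) (hγ n) (hC n) hC0 hδ hδ1 hl (fun m hm => ?_) ?_
  · have h2 := hn m (Finset.mem_range_succ_iff.2 hm)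
    rwa [← sub_div, div_le_iff₀ (by positivity)] at h2
  · have h2 : 8 * R / δ * C ≤ (((G n).diam : ℝ) + 1) * C := by linarith [hC n]
    have h3 := le_of_mul_le_mul_right h2 hC0
    rwa [div_le_iff₀' hδ] at h3

end

end BSLimit

open BSLimit in
theorem theorem2
    {V : ℕ → Type*} [∀ n, Fintype (V n)]
    (G : ∀ n, SimpleGraph (V n)) (hG : ∀ n, (G n).Connected)
    {S : Type*} [MeasurableSpace S] (P : Measure S) [IsProbabilityMeasure P]
    (X : S → BSLimit.RootedGraph) (hX : Measurable X)
    (hinf : ∀ᵐ ω ∂P, Infinite (X ω).V)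
    (hconv : BSLimit.BenjaminiSchrammConverges G hG P X hX)
    (C : ℝ) (hC : ∀ n, (Fintype.card (V n) : ℝ) ≤ C * ((G n).diam : ℝ)) :
    ∃ A : Set S, MeasurableSet A ∧ 1 / C ≤ P.real A ∧
      (∀ᵐ ω ∂P, ω ∈ A → BSLimit.IsEnded (X ω).graph 2 ∧ BSLimit.HasLinearGrowth (X ω).graph) ∧
      (∀ᵐ ω ∂P, ω ∈ A → BSLimit.ConvergesToLine (X ω)) := by
  have hC0 : 0 < C := by
    have := (hG 0).nonempty
    have h1 : (0 : ℝ) < Fintype.card (V 0) := by exact_mod_cast Fintype.card_pos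
    by_contra h
    have := mul_nonpos_of_nonpos_of_nonneg (not_lt.1 h) (Nat.cast_nonneg (α := ℝ) (G 0).diam)
    linarith [hC 0]
  have hC' : ∀ n, (Fintype.card (V n) : ℝ) ≤ C * ((G n).diam + 1) := fun n => by
    linarith [hC n]
  choose l K hlK using fun q : ℕ => exists_forall_le_lineEvent hconv hinf hC0 hC'
    (δ := 1 / ((q : ℝ) + 1)) (by positivity)
    (div_le_one_of_le₀ (by linarith [Nat.cast_nonneg (α := ℝ) q]) (by positivity))
  have hmeas : ∀ q R, MeasurableSet (X ⁻¹' lineEvent (l q) (K q) R) := fun q R =>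
    hX (isClopen_lineEvent _ _ R).isOpen.measurableSet
  have hA : ∀ ω ∈ ⋃ q, ⋂ R, X ⁻¹' lineEvent (l q) (K q) R,
      ∃ q, (∀ r, BallGrowth (X ω) (l q) r) ∧ ∀ m r, NearAxis (X ω) (m + 1) (K q m) r := by
    intro ω hω
    simp only [Set.mem_iUnion, Set.mem_iInter] at hω
    obtain ⟨q, hq⟩ := hω
    exact ⟨q, fun r => (hq r r le_rfl).1, fun m r =>
      (hq (max m r) r (le_max_right _ _)).2 m (le_max_left _ _)⟩
  refine ⟨⋃ q, ⋂ R, X ⁻¹' lineEvent (l q) (K q) R,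
    MeasurableSet.iUnion fun q => MeasurableSet.iInter (hmeas q), ?_,
    ae_of_all _ fun ω hω => ?_, ae_of_all _ fun ω hω => ?_⟩
  · have h1 : ∀ q : ℕ, (1 - 1 / ((q : ℝ) + 1)) / C ≤
        P.real (⋃ q, ⋂ R, X ⁻¹' lineEvent (l q) (K q) R) := by
      intro q
      have h2 : Tendsto (fun R => P.real (X ⁻¹' lineEvent (l q) (K q) R)) atTop
          (𝓝 (P.real (⋂ R, X ⁻¹' lineEvent (l q) (K q) R))) :=
        (ENNReal.tendsto_toReal (measure_ne_top _ _)).comp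
          (tendsto_measure_iInter_atTop (fun R => (hmeas q R).nullMeasurableSet)
            (fun R T hRT => Set.preimage_mono (lineEvent_antitone _ _ hRT))
            ⟨0, measure_ne_top _ _⟩)
      exact (ge_of_tendsto' h2 (hlK q)).trans
        (measureReal_mono (Set.subset_iUnion (fun q => ⋂ R, X ⁻¹' lineEvent (l q) (K q) R) q))
    have h3 : Tendsto (fun q : ℕ => (1 - 1 / ((q : ℝ) + 1)) / C) atTop (𝓝 ((1 - 0) / C)) :=
      (tendsto_one_div_add_atTop_nhds_zero_nat.const_sub 1).div_const C
    rw [sub_zero] at h3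
    exact le_of_tendsto' h3 h1
  · obtain ⟨q, h1, h2⟩ := hA ω hω
    exact ⟨isEnded_two_of_nearAxis (h2 49), hasLinearGrowth_of_ballGrowth h1⟩
  · obtain ⟨q, -, h2⟩ := hA ω hω
    exact convergesToLine_of_nearAxis fun m => ⟨K q m, h2 m⟩
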